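/- **Conventions.** Let $E$ be a (real or complex) Banach space with closed unit ball $B_E$ and unit sphere $S_E$. A slice of $B_E$ is a set $S(\varphi,\varepsilon)=\{x\in B_E:\operatorname{Re}\varphi(x)>\sup_{B_E}\operatorname{Re}\varphi-\varepsilon\}$ with $\varphi\in S_{E^*}$, $\varepsilon>0$. A convex combination of slices is a set $\sum_{i=1}^n\lambda_iS_i$ with $\lambda_i>0$, $\sum_i\lambda_i=1$ and slices $S_1,\dots,S_n$ of $B_E$. A point $x\in S_E$ is called *ccs-Daugavet* (resp. *super-Daugavet*, *Daugavet*) if $\sup_{y\in C}\|x-y\|=2$ for every convex combination of slices (resp. every nonempty relatively weakly open subset, every slice) $C$ of $B_E$; *ccs-$\Delta$* (resp. *super-$\Delta$*, *$\Delta$*) if this holds for all such $C$ that contain $x$; and *$\nabla$* if it holds for all slices $C$ that do not contain $x$. For $p>1$, $x\in S_E$ is a *$\Delta_p$* point if for all $\varphi\in S_{E^*}$, $\alpha>0$ with $x\in S(\varphi,\alpha)$ and all $\varepsilon>0$ there is $u\in S(\varphi,p\alpha)$ with $\|x-u\|\ge 2-\varepsilon$. For a measure space $(\Omega,\Sigma,\mu)$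 and a Banach space $X$, $L_\infty(\mu,X)$ is the space of classes (modulo a.e. equality) of essentially bounded functions $\Omega\to X$ that are a.e. limits of simple functions with supports of finite measure, with the essential supremum norm. An atom is a measurable set $A$ with $0<\mu(A)<\infty$ such that every measurable $B\subset A$ satisfies $\mu(B)=0$ or $\mu(A\setminus B)=0$; atoms that are equal up to a null set are identified. A set is atomless if it contains no atom. For measurable $S$, $f|_S$ is regarded as an element of $L_\infty(\mu|_S,X)$. **Theorem.** Let $(\Omega,\Sigma,\mu)$ be a measure space, $X$ a real or complex Banach space, and $f\in S_{L_\infty(\mu,X)}$. Suppose that there is an atom $A_0$ with $\mu(\Omega\setminus A_0)>0$, and let $\{A_i:i\in I\}$ be the distinct atoms. 1. If there is an atomless measurable set $S\subset\operatorname{supp}(f)$ with $\|f|_S\|=1$, then $f$ is a ccs-Daugavet point. 2. If for every $\varepsilon>0$ there are infinitely many $i\in I$ with $\|f|_{A_i}\|>1-\frac{\varepsilon}{2}$, then $f$ is a Daugavet point. 3. If neither the assumption of 1 nor that of 2 holds, let $J=\{i\in I:\|f|_{A_i}\|=1\}$ and $\mathcal B=\bigcup_{j\in J}A_j$. Then $J$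 is finite and non-empty, $L_\infty(\mu|_{\mathcal B},X)$ is isometrically isomorphic to the $\ell_\infty$-sum of $|J|$ copies of $X$, and $L_\infty(\mu|_{A_j},X)$ to $X$ for $j\in J$ (in both cases by sending a function to its a.e. constant values on the atoms), and: - (a) $f$ is super-Daugavet (resp. super-$\Delta$, ccs-Daugavet) if and only if $f|_{\mathcal B}$ is super-Daugavet (resp. super-$\Delta$, ccs-Daugavet) in $L_\infty(\mu|_{\mathcal B},X)$. - (b) $f$ is Daugavet if and only if there is $j\in J$ such that $f|_{A_j}$ is Daugavet in $L_\infty(\mu|_{A_j},X)$. - (c) If $f$ is ccs-$\Delta$, then $f|_{\mathcal B}$ is ccs-$\Delta$ in $L_\infty(\mu|_{\mathcal B},X)$. - (d) $f$ is $\Delta$ if and only if either there is $j\in J$ such that $f|_{A_j}$ is $\Delta$ in $L_\infty(\mu|_{A_j},X)$, or $|J|\ge 2$ and for every family $(p_j)_{j\in J}\subset(1,\infty)$ with $\sum_{j\in J}\frac1{p_j}=1$ there is $j\in J$ such that $f|_{A_j}$ is $\Delta_{p_j}$ in $L_\infty(\mu|_{A_j},X)$. - (e) If $\Omega\setminus\mathcal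 B$ contains a measurable set of positive finite measure, or if the scalar field is $\mathbb C$, then $f$ is $\nabla$ if and only if $f$ is Daugavet. - (f) If $\Omega\setminus\mathcal B$ contains no measurable set of positive finite measure (in particular, if $\Omega=\mathcal B$), then $f$ is $\nabla$ if and only if either $f|_{A_j}$ is $\nabla$ in $L_\infty(\mu|_{A_j},X)$ for all $j\in J$, or there is $j\in J$ such that $f|_{A_j}$ is Daugavet in $L_\infty(\mu|_{A_j},X)$ (and in the latter case $f$ is Daugavet as well). -/

import Mathlib

open MeasureTheory Filter Topology
open scoped ENNReal

namespace Diametral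

section Points

variable (𝕜 : Type*) {E : Type*} [RCLike 𝕜] [NormedAddCommGroup E] [NormedSpace 𝕜 E]

/-- The set `{x ∈ A : re φ(x) > sup_A re φ - ε}`; a slice of `A` when `‖φ‖ = 1` and `ε > 0`. -/
def sliceOf (A : Set E) (φ : E →L[𝕜] 𝕜) (ε : ℝ) : Set E :=
  {x | x ∈ A ∧ sSup ((fun y => RCLike.re (φ y)) '' A) - ε < RCLike.re (φ x)}

/-- `S` is a slice of the closed unit ball of `E`. -/
def IsSlice (S : Set E) : Prop :=
  ∃ (φ : E →L[𝕜] 𝕜) (ε : ℝ), ‖φ‖ = 1 ∧ 0 < ε ∧ S = sliceOf 𝕜 (Metric.closedBall (0 : E) 1) φ ε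

/-- `C` is a convex combination of slices of the closed unit ball of `E`. -/
def IsConvexCombSlices (C : Set E) : Prop :=
  ∃ (n : ℕ) (c : Fin n → ℝ) (S : Fin n → Set E),
    (∀ i, 0 < c i) ∧ ∑ i, c i = 1 ∧ (∀ i, IsSlice 𝕜 (S i)) ∧
    C = {x | ∃ y : Fin n → E, (∀ i, y i ∈ S i) ∧ x = ∑ i, ((c i : ℝ) : 𝕜) • y i}

/-- `W` is a nonempty relatively weakly open subset of the closed unit ball of `E`. -/
def IsWeaklyOpenInBall (W : Set E) : Prop :=
  W.Nonempty ∧ ∃ U : Set (WeakSpace 𝕜 E), IsOpen U ∧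
    W = Metric.closedBall (0 : E) 1 ∩ (toWeakSpace 𝕜 E) ⁻¹' U

/-- `sup_{y ∈ C} ‖x - y‖ = 2`. -/
def SupDistTwo (x : E) (C : Set E) : Prop :=
  IsLUB ((fun y => ‖x - y‖) '' C) 2

def IsCcsDaugavet (x : E) : Prop :=
  ‖x‖ = 1 ∧ ∀ C : Set E, IsConvexCombSlices 𝕜 C → SupDistTwo x C

def IsSuperDaugavet (x : E) : Prop :=
  ‖x‖ = 1 ∧ ∀ W : Set E, IsWeaklyOpenInBall 𝕜 W → SupDistTwo x W

def IsDaugavet (x : E) : Prop :=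
  ‖x‖ = 1 ∧ ∀ S : Set E, IsSlice 𝕜 S → SupDistTwo x S

def IsCcsDelta (x : E) : Prop :=
  ‖x‖ = 1 ∧ ∀ C : Set E, IsConvexCombSlices 𝕜 C → x ∈ C → SupDistTwo x C

def IsSuperDelta (x : E) : Prop :=
  ‖x‖ = 1 ∧ ∀ W : Set E, IsWeaklyOpenInBall 𝕜 W → x ∈ W → SupDistTwo x W

def IsDelta (x : E) : Prop :=
  ‖x‖ = 1 ∧ ∀ S : Set E, IsSlice 𝕜 S → x ∈ S → SupDistTwo x S

def IsNabla (x : E) : Prop :=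
  ‖x‖ = 1 ∧ ∀ S : Set E, IsSlice 𝕜 S → x ∉ S → SupDistTwo x S

/-- `x` is a `Δ_p` point (used for `p > 1`). -/
def IsDeltaP (p : ℝ) (x : E) : Prop :=
  ‖x‖ = 1 ∧ ∀ (φ : E →L[𝕜] 𝕜) (α : ℝ), ‖φ‖ = 1 → 0 < α →
    x ∈ sliceOf 𝕜 (Metric.closedBall (0 : E) 1) φ α →
    ∀ ε : ℝ, 0 < ε → ∃ u ∈ sliceOf 𝕜 (Metric.closedBall (0 : E) 1) φ (p * α), 2 - ε ≤ ‖x - u‖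

end Points

section Space

variable (𝕜 X : Type*) {Ω : Type*} [RCLike 𝕜] [NormedAddCommGroup X] [NormedSpace 𝕜 X]
  [MeasurableSpace Ω]

theorem aefsm_congr {X : Type*} [NormedAddCommGroup X] {μ : Measure Ω} {f g : Ω → X}
    (hf : AEFinStronglyMeasurable f μ) (h : g =ᵐ[μ] f) : AEFinStronglyMeasurable g μ := by
  obtain ⟨k, hk, hfk⟩ := hf
  exact ⟨k, hk, h.trans hfk⟩

theorem aefsm_restrict {X : Type*} [NormedAddCommGroup X] {μ : Measure Ω} {f : Ω → X}
    (hf : AEFinStronglyMeasurable f μ) (S : Set Ω) :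
    AEFinStronglyMeasurable f (μ.restrict S) := by
  obtain ⟨k, ⟨fs, hfs, hlim⟩, hfk⟩ := hf
  exact ⟨k, ⟨fs, fun n => (Measure.restrict_apply_le S _).trans_lt (hfs n), hlim⟩,
    ae_restrict_of_ae hfk⟩

/-- The space `L_∞(μ, X)` of (classes of) essentially bounded strongly `μ`-measurable functions,
i.e. a.e. limits of simple functions with supports of finite measure,
with the essential supremum norm. -/
def Linf (μ : Measure Ω) : Submodule 𝕜 (Lp X ∞ μ) where
  carrier := {f | AEFinStronglyMeasurable f μ}
  zero_mem' := aefsm_congr (f := fun _ => (0 : X))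
    ⟨_, ⟨fun _ => 0, by simp, fun _ => by simp⟩, EventuallyEq.rfl⟩ (Lp.coeFn_zero X ∞ μ)
  add_mem' {f g} hf hg := aefsm_congr (hf.add hg) (Lp.coeFn_add f g)
  smul_mem' c f hf := aefsm_congr (hf.const_smul c) (Lp.coeFn_smul c f)

variable {𝕜 X}

/-- The restriction `f|_S`, an element of `L_∞(μ|_S, X)`. -/
noncomputable def restr {μ : Measure Ω} (f : Linf 𝕜 X μ) (S : Set Ω) :
    Linf 𝕜 X (μ.restrict S) :=
  ⟨((Lp.memLp (f : Lp X ∞ μ)).restrict S).toLp,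
    aefsm_congr (aefsm_restrict f.2 S) (MemLp.coeFn_toLp _)⟩

/-- Atoms of finite measure. -/
def IsAtom (μ : Measure Ω) (A : Set Ω) : Prop :=
  MeasurableSet A ∧ 0 < μ A ∧ μ A < ∞ ∧
    ∀ B : Set Ω, MeasurableSet B → B ⊆ A → μ B = 0 ∨ μ (A \ B) = 0

/-- `S` contains no atom. -/
def IsAtomless (μ : Measure Ω) (S : Set Ω) : Prop :=
  ∀ B : Set Ω, B ⊆ S → ¬ IsAtom μ B

/-- `(A i)` lists all the distinct atoms of `μ`: atoms that agree almost everywhere are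
identified, and each class is listed exactly once. -/
def IsAtomEnumeration (μ : Measure Ω) {I : Type*} (A : I → Set Ω) : Prop :=
  (∀ i, IsAtom μ (A i)) ∧ (∀ i j, A i =ᵐ[μ] A j → i = j) ∧
    ∀ B : Set Ω, IsAtom μ B → ∃ i, B =ᵐ[μ] A i

/-- There is an atomless measurable set contained in the support of `f` on which `f` has
norm one. -/
def HasAtomlessNormingSet {μ : Measure Ω} (f : Linf 𝕜 X μ) : Prop :=
  ∃ S : Set Ω, MeasurableSet S ∧
    (∀ᵐ ω ∂μ, ω ∈ S → (f : Lp X ∞ μ) ω ≠ 0) ∧ IsAtomless μ S ∧ ‖restr f S‖ = 1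

/-- For every `ε > 0` there are infinitely many distinct atoms on which `f` has norm larger
than `1 - ε / 2`. -/
def HasInfinitelyManyAlmostNormingAtoms {μ : Measure Ω} {I : Type*} (A : I → Set Ω)
    (f : Linf 𝕜 X μ) : Prop :=
  ∀ ε : ℝ, 0 < ε → {i | 1 - ε / 2 < ‖restr f (A i)‖}.Infinite

/-- `S` contains a measurable set of positive finite measure, i.e. `S` is not negligible for
strongly `μ`-measurable functions. -/
def HasFinitePart (μ : Measure Ω) (S : Set Ω) : Prop :=
  ∃ T : Set Ω, MeasurableSet T ∧ T ⊆ S ∧ 0 < μ T ∧ μ T < ∞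

end Space

end Diametral

/-! Two mechanisms carry the theorem. The first treats a function `f` that is almost normed on
arbitrarily many disjoint sets, found inside an atomless norming set or among infinitely many atoms.
Indicators of these sets give orthogonal M-projections `Q m`. Given points `g k` of finitely many
slices, the numbers `|re φ k (Q m (g k + f))|` have a sum over `m` that is bounded independently of
how many projections there are (`sum_abs_re_mprojection_le`). Hence for some `m` they are negligible
for all `k` at once, and overwriting the `m`-th component of every `g k` by `-Q m f` leaves ball and
slices intact. Every convex combination of the new points has distance at least `2 * ‖Q m f‖` from
`f` (`isCcsDaugavet_of_mprojections`).

Otherwise only finitely many atoms norm `f`, and off them `‖f‖` is bounded by some `r < 1`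
(`exists_bound_off_norming_atoms`). Functions are a.e. constant on atoms, so the space is an
`ℓ_∞`-sum of `X^J` and a complement in which `f` has norm below one (`atomSummand`). A point of the
ball almost at distance 2 from `f` must then be so in the `X^J` component (`far_proj`). Conversely,
points of `X^J` are lifted to prescribed slices or weakly open sets by adding a suitable
complementary component (`lift`, `glue`). This reduces everything but ∇ to `X^J`.

In `X^J` the dual norm is an `ℓ_1`-sum, so the deficit `‖φ‖ - re φ(v)` of a functional is the sum of
the deficits of its coordinates. Bad slices of the factors therefore combine to a bad slice of the
power (`exists_forall_norm_sub_le`), and distributing a total deficit over the coordinates is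
exactly what produces the exponents `p j` with `∑ 1 / p j = 1`.

For ∇ points only the functionals norming the point escape control. If each of them can be
approximated by functionals that do not attain their norm there, the point is Daugavet
(`IsNabla.isDaugavet_of_perturb`). A nonzero complement or the imaginary unit supplies the
perturbation; without a nonzero complement the problem is one about `X^J` itself (`isNabla_pi_iff`).
-/

namespace Diametral

/-! ### Slices of functionals of arbitrary norm, and pointwise forms of the diametral notions -/

section Characterizations

variable {𝕜 : Type*} {E : Type*} [RCLike 𝕜] [NormedAddCommGroup E] [NormedSpace 𝕜 E]

/-- The part of the closed unit ball where `re φ` exceeds `‖φ‖ - ε`, for a functional `φ` of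
arbitrary norm. -/
def halfBall (φ : E →L[𝕜] 𝕜) (ε : ℝ) : Set E :=
  {x | ‖x‖ ≤ 1 ∧ ‖φ‖ - ε < RCLike.re (φ x)}

theorem re_apply_le_norm (φ : E →L[𝕜] 𝕜) {x : E} (hx : ‖x‖ ≤ 1) : RCLike.re (φ x) ≤ ‖φ‖ :=
  (RCLike.re_le_norm _).trans (φ.unit_le_opNorm x hx)

theorem halfBall_nonempty (φ : E →L[𝕜] 𝕜) {ε : ℝ} (hε : 0 < ε) : (halfBall φ ε).Nonempty := by
  obtain ⟨x, hx, hφ⟩ := φ.exists_lt_apply_of_lt_opNorm (r := ‖φ‖ - ε) (by linarith)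
  by_cases h0 : φ x = 0
  · exact ⟨x, hx.le, by rw [h0]; rw [h0] at hφ; simpa using hφ⟩
  · refine ⟨((starRingEnd 𝕜) (φ x) / (‖φ x‖ : 𝕜)) • x, ?_, ?_⟩
    · rw [norm_smul, norm_div, RCLike.norm_conj]
      simp [h0, hx.le]
    · have h1 : (‖φ x‖ : 𝕜) ≠ 0 := by simpa using h0
      have h2 : φ (((starRingEnd 𝕜) (φ x) / (‖φ x‖ : 𝕜)) • x) = (‖φ x‖ : 𝕜) := by
        rw [map_smul, smul_eq_mul, div_mul_eq_mul_div, RCLike.conj_mul, sq, mul_div_assoc,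
          div_self h1, mul_one]
      rw [h2]
      simpa using hφ

theorem sSup_re_image_closedBall (φ : E →L[𝕜] 𝕜) :
    sSup ((fun y => RCLike.re (φ y)) '' Metric.closedBall (0 : E) 1) = ‖φ‖ := by
  refine IsLUB.csSup_eq ⟨?_, fun b hb => ?_⟩ (Set.Nonempty.image _ ⟨0, by simp⟩)
  · rintro _ ⟨x, hx, rfl⟩
    exact re_apply_le_norm φ (by simpa using hx)
  · refine le_of_forall_pos_lt_add fun ε hε => ?_
    obtain ⟨x, hx, h⟩ := halfBall_nonempty φ hε
    have := hb ⟨x, by simpa using hx, rfl⟩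
    simp only at this
    linarith

theorem sliceOf_closedBall (φ : E →L[𝕜] 𝕜) (ε : ℝ) :
    sliceOf 𝕜 (Metric.closedBall (0 : E) 1) φ ε = halfBall φ ε := by
  ext x
  simp [sliceOf, halfBall, sSup_re_image_closedBall]

theorem halfBall_smul (φ : E →L[𝕜] 𝕜) (ε : ℝ) {r : ℝ} (hr : 0 < r) :
    halfBall ((r : 𝕜) • φ) (r * ε) = halfBall φ ε := by
  ext x
  simp only [halfBall, Set.mem_ofPred_eq, norm_smul, smul_apply, smul_eq_mul,
    RCLike.re_ofReal_mul, RCLike.norm_ofReal, abs_of_pos hr, ← mul_sub, mul_lt_mul_iff_right₀ hr]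

theorem exists_norm_eq_one_dual {x : E} (hx : ‖x‖ = 1) : ∃ φ : E →L[𝕜] 𝕜, ‖φ‖ = 1 ∧ φ x = 1 := by
  obtain ⟨φ, h1, h2⟩ := exists_dual_vector 𝕜 x (by simp [hx])
  exact ⟨φ, h1, by simp [h2, hx]⟩

/-- Dropping the normalisation `‖φ‖ = 1` matters because restrictions of functionals to summands
have uncontrolled norm, possibly zero. -/
theorem isSlice_iff_halfBall {x : E} (hx : ‖x‖ = 1) {S : Set E} :
    IsSlice 𝕜 S ↔ ∃ (φ : E →L[𝕜] 𝕜) (ε : ℝ), 0 < ε ∧ S = halfBall φ ε := by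
  constructor
  · rintro ⟨φ, ε, -, hε, rfl⟩
    exact ⟨φ, ε, hε, sliceOf_closedBall φ ε⟩
  · rintro ⟨φ, ε, hε, rfl⟩
    by_cases h0 : φ = 0
    · obtain ⟨ψ, hψ, -⟩ := exists_norm_eq_one_dual (𝕜 := 𝕜) hx
      -- For `φ = 0` the half-ball is the whole ball, which is also the slice of any normalised
      -- functional with depth exceeding 2.
      refine ⟨ψ, 3, hψ, by norm_num, ?_⟩
      rw [sliceOf_closedBall]
      ext y
      simp only [halfBall, h0, Set.mem_ofPred_eq, hψ, norm_zero, zero_apply,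
        map_zero, and_congr_right_iff]
      intro hy
      have := re_apply_le_norm (-ψ) hy
      simp only [norm_neg, neg_apply, map_neg, hψ] at this
      constructor <;> intro <;> linarith
    · have h : 0 < ‖φ‖⁻¹ := inv_pos.2 (norm_pos_iff.2 h0)
      refine ⟨((‖φ‖⁻¹ : ℝ) : 𝕜) • φ, ‖φ‖⁻¹ * ε, ?_, by positivity, ?_⟩
      · rw [norm_smul, RCLike.norm_ofReal, abs_of_pos h, inv_mul_cancel₀ (by simpa using h0)]
      · rw [sliceOf_closedBall, halfBall_smul _ _ h]

theorem supDistTwo_iff {x : E} (hx : ‖x‖ = 1) {C : Set E} (hC : ∀ y ∈ C, ‖y‖ ≤ 1) :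
    SupDistTwo x C ↔ ∀ η : ℝ, 0 < η → ∃ y ∈ C, 2 - η < ‖x - y‖ := by
  constructor
  · intro h η hη
    obtain ⟨_, ⟨y, hy, rfl⟩, h'⟩ := (lt_isLUB_iff h).1 (show 2 - η < 2 by linarith)
    exact ⟨y, hy, h'⟩
  · refine fun h => ⟨?_, fun b hb => ?_⟩
    · rintro _ ⟨y, hy, rfl⟩
      have := norm_sub_le x y
      have := hC y hy
      simp only
      linarith
    · refine le_of_forall_pos_lt_add fun η hη => ?_
      obtain ⟨y, hy, h'⟩ := h η hη
      have := hb ⟨y, hy, rfl⟩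
      simp only at this
      linarith

theorem isDaugavet_iff {x : E} : IsDaugavet 𝕜 x ↔ ‖x‖ = 1 ∧ ∀ (φ : E →L[𝕜] 𝕜) (ε η : ℝ),
    0 < ε → 0 < η → ∃ y ∈ halfBall φ ε, 2 - η < ‖x - y‖ := by
  refine and_congr_right fun hx => ⟨fun h φ ε η hε hη => ?_, fun h S hS => ?_⟩
  · exact (supDistTwo_iff hx fun y hy => hy.1).1
      (h _ ((isSlice_iff_halfBall hx).2 ⟨φ, ε, hε, rfl⟩)) η hη
  · obtain ⟨φ, ε, hε, rfl⟩ := (isSlice_iff_halfBall hx).1 hS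
    exact (supDistTwo_iff hx fun y hy => hy.1).2 fun η hη => h φ ε η hε hη

theorem isDelta_iff {x : E} : IsDelta 𝕜 x ↔ ‖x‖ = 1 ∧ ∀ (φ : E →L[𝕜] 𝕜) (ε η : ℝ),
    0 < ε → x ∈ halfBall φ ε → 0 < η → ∃ y ∈ halfBall φ ε, 2 - η < ‖x - y‖ := by
  refine and_congr_right fun hx => ⟨fun h φ ε η hε hm hη => ?_, fun h S hS hm => ?_⟩
  · exact (supDistTwo_iff hx fun y hy => hy.1).1
      (h _ ((isSlice_iff_halfBall hx).2 ⟨φ, ε, hε, rfl⟩) hm) η hη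
  · obtain ⟨φ, ε, hε, rfl⟩ := (isSlice_iff_halfBall hx).1 hS
    exact (supDistTwo_iff hx fun y hy => hy.1).2 fun η hη => h φ ε η hε hm hη

theorem isNabla_iff {x : E} : IsNabla 𝕜 x ↔ ‖x‖ = 1 ∧ ∀ (φ : E →L[𝕜] 𝕜) (ε η : ℝ),
    0 < ε → x ∉ halfBall φ ε → 0 < η → ∃ y ∈ halfBall φ ε, 2 - η < ‖x - y‖ := by
  refine and_congr_right fun hx => ⟨fun h φ ε η hε hm hη => ?_, fun h S hS hm => ?_⟩
  · exact (supDistTwo_iff hx fun y hy => hy.1).1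
      (h _ ((isSlice_iff_halfBall hx).2 ⟨φ, ε, hε, rfl⟩) hm) η hη
  · obtain ⟨φ, ε, hε, rfl⟩ := (isSlice_iff_halfBall hx).1 hS
    exact (supDistTwo_iff hx fun y hy => hy.1).2 fun η hη => h φ ε η hε hm hη

/-- The convex combination of the sets `S i` with weights `c i`. -/
def combo (𝕜 : Type*) [RCLike 𝕜] [NormedSpace 𝕜 E] {n : ℕ} (c : Fin n → ℝ) (S : Fin n → Set E) :
    Set E :=
  {x | ∃ y : Fin n → E, (∀ i, y i ∈ S i) ∧ x = ∑ i, ((c i : ℝ) : 𝕜) • y i}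

theorem norm_le_of_mem_combo {n : ℕ} {c : Fin n → ℝ} {S : Fin n → Set E} (hc : ∀ i, 0 < c i)
    (hc1 : ∑ i, c i = 1) (hS : ∀ i, ∀ y ∈ S i, ‖y‖ ≤ 1) {x : E} (hx : x ∈ combo 𝕜 c S) :
    ‖x‖ ≤ 1 := by
  obtain ⟨y, hy, rfl⟩ := hx
  calc _ ≤ ∑ i, ‖((c i : ℝ) : 𝕜) • y i‖ := norm_sum_le _ _
    _ ≤ ∑ i, c i := Finset.sum_le_sum fun i _ => by
        rw [norm_smul, RCLike.norm_ofReal, abs_of_pos (hc i)]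
        exact mul_le_of_le_one_right (hc i).le (hS i _ (hy i))
    _ = 1 := hc1

theorem isConvexCombSlices_iff {x : E} (hx : ‖x‖ = 1) {C : Set E} :
    IsConvexCombSlices 𝕜 C ↔ ∃ (n : ℕ) (c : Fin n → ℝ) (φ : Fin n → E →L[𝕜] 𝕜) (ε : Fin n → ℝ),
      (∀ i, 0 < c i) ∧ ∑ i, c i = 1 ∧ (∀ i, 0 < ε i) ∧
      C = combo 𝕜 c fun i => halfBall (φ i) (ε i) := by
  constructor
  · rintro ⟨n, c, S, hc, hc1, hS, rfl⟩
    choose φ ε hε h using fun i => (isSlice_iff_halfBall hx).1 (hS i)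
    obtain rfl : S = fun i => halfBall (φ i) (ε i) := funext h
    exact ⟨n, c, φ, ε, hc, hc1, hε, rfl⟩
  · rintro ⟨n, c, φ, ε, hc, hc1, hε, rfl⟩
    exact ⟨n, c, _, hc, hc1, fun i => (isSlice_iff_halfBall hx).2 ⟨φ i, ε i, hε i, rfl⟩, rfl⟩

theorem isCcsDaugavet_iff {x : E} : IsCcsDaugavet 𝕜 x ↔ ‖x‖ = 1 ∧ ∀ (n : ℕ) (c : Fin n → ℝ)
    (φ : Fin n → E →L[𝕜] 𝕜) (ε : Fin n → ℝ) (η : ℝ), (∀ i, 0 < c i) → ∑ i, c i = 1 →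
    (∀ i, 0 < ε i) → 0 < η → ∃ y : Fin n → E, (∀ i, y i ∈ halfBall (φ i) (ε i)) ∧
      2 - η < ‖x - ∑ i, ((c i : ℝ) : 𝕜) • y i‖ := by
  refine and_congr_right fun hx => ⟨fun h n c φ ε η hc hc1 hε hη => ?_, fun h C hC => ?_⟩
  · obtain ⟨_, ⟨y, hy, rfl⟩, h'⟩ := (supDistTwo_iff hx fun y hy =>
      norm_le_of_mem_combo hc hc1 (fun i y hy => hy.1) hy).1
      (h _ ((isConvexCombSlices_iff hx).2 ⟨n, c, φ, ε, hc, hc1, hε, rfl⟩)) η hη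
    exact ⟨y, hy, h'⟩
  · obtain ⟨n, c, φ, ε, hc, hc1, hε, rfl⟩ := (isConvexCombSlices_iff hx).1 hC
    refine (supDistTwo_iff hx fun y hy =>
      norm_le_of_mem_combo hc hc1 (fun i y hy => hy.1) hy).2 fun η hη => ?_
    obtain ⟨y, hy, h'⟩ := h n c φ ε η hc hc1 hε hη
    exact ⟨_, ⟨y, hy, rfl⟩, h'⟩

theorem isCcsDelta_iff {x : E} : IsCcsDelta 𝕜 x ↔ ‖x‖ = 1 ∧ ∀ (n : ℕ) (c : Fin n → ℝ)
    (φ : Fin n → E →L[𝕜] 𝕜) (ε : Fin n → ℝ) (η : ℝ), (∀ i, 0 < c i) → ∑ i, c i = 1 →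
    (∀ i, 0 < ε i) → x ∈ combo 𝕜 c (fun i => halfBall (φ i) (ε i)) → 0 < η →
    ∃ y : Fin n → E, (∀ i, y i ∈ halfBall (φ i) (ε i)) ∧
      2 - η < ‖x - ∑ i, ((c i : ℝ) : 𝕜) • y i‖ := by
  refine and_congr_right fun hx => ⟨fun h n c φ ε η hc hc1 hε hm hη => ?_, fun h C hC hm => ?_⟩
  · obtain ⟨_, ⟨y, hy, rfl⟩, h'⟩ := (supDistTwo_iff hx fun y hy =>
      norm_le_of_mem_combo hc hc1 (fun i y hy => hy.1) hy).1
      (h _ ((isConvexCombSlices_iff hx).2 ⟨n, c, φ, ε, hc, hc1, hε, rfl⟩) hm) η hη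
    exact ⟨y, hy, h'⟩
  · obtain ⟨n, c, φ, ε, hc, hc1, hε, rfl⟩ := (isConvexCombSlices_iff hx).1 hC
    refine (supDistTwo_iff hx fun y hy =>
      norm_le_of_mem_combo hc hc1 (fun i y hy => hy.1) hy).2 fun η hη => ?_
    obtain ⟨y, hy, h'⟩ := h n c φ ε η hc hc1 hε hm hη
    exact ⟨_, ⟨y, hy, rfl⟩, h'⟩

theorem IsCcsDaugavet.isDaugavet {x : E} (h : IsCcsDaugavet 𝕜 x) : IsDaugavet 𝕜 x := by
  rw [isCcsDaugavet_iff] at h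
  refine isDaugavet_iff.2 ⟨h.1, fun φ ε η hε hη => ?_⟩
  obtain ⟨y, hy, h'⟩ := h.2 1 (fun _ => 1) (fun _ => φ) (fun _ => ε) η (by simp) (by simp)
    (by simpa using hε) hη
  exact ⟨y 0, hy 0, by simpa using h'⟩

theorem IsDaugavet.isNabla {x : E} (h : IsDaugavet 𝕜 x) : IsNabla 𝕜 x :=
  ⟨h.1, fun S hS _ => h.2 S hS⟩

theorem isDeltaP_iff {p : ℝ} (hp : 0 < p) {x : E} : IsDeltaP 𝕜 p x ↔ ‖x‖ = 1 ∧
    ∀ (φ : E →L[𝕜] 𝕜) (α η : ℝ), 0 < α → x ∈ halfBall φ α → 0 < η →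
      ∃ y ∈ halfBall φ (p * α), 2 - η < ‖x - y‖ := by
  refine and_congr_right fun hx => ⟨fun h φ α η hα hm hη => ?_, fun h φ α _ hα hm ε hε => ?_⟩
  · by_cases h0 : φ = 0
    -- The zero functional imposes no constraint, so the antipode serves.
    · refine ⟨-x, ⟨by simp [hx], ?_⟩, ?_⟩
      · simp only [h0, norm_zero, zero_apply, map_zero]
        nlinarith
      · rw [sub_neg_eq_add, ← two_smul 𝕜 x, norm_smul, hx, RCLike.norm_ofNat]
        linarith
    · have hr : 0 < ‖φ‖⁻¹ := inv_pos.2 (norm_pos_iff.2 h0)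
      have h1 : ‖((‖φ‖⁻¹ : ℝ) : 𝕜) • φ‖ = 1 := by
        rw [norm_smul, RCLike.norm_ofReal, abs_of_pos hr, inv_mul_cancel₀ (by simpa using h0)]
      obtain ⟨y, hy, h'⟩ := h (((‖φ‖⁻¹ : ℝ) : 𝕜) • φ) (‖φ‖⁻¹ * α) h1 (by positivity)
        (by rwa [sliceOf_closedBall, halfBall_smul _ _ hr]) (η / 2) (by linarith)
      rw [sliceOf_closedBall, mul_left_comm, halfBall_smul _ _ hr] at hy
      exact ⟨y, hy, by linarith⟩
  · rw [sliceOf_closedBall] at hm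
    obtain ⟨y, hy, h'⟩ := h φ α ε hα hm hε
    exact ⟨y, by rwa [sliceOf_closedBall], h'.le⟩

/-- The boundary exponent is what appears when there is only one norming atom. -/
theorem isDeltaP_one_iff {x : E} : IsDeltaP 𝕜 1 x ↔ IsDelta 𝕜 x := by
  rw [isDeltaP_iff one_pos, isDelta_iff]
  simp only [one_mul]

/-- A `∇` point is Daugavet if every functional that attains its norm at the point can be perturbed
to one that does not. -/
theorem IsNabla.isDaugavet_of_perturb {x : E} (hx : IsNabla 𝕜 x)
    (H : ∀ φ : E →L[𝕜] 𝕜, ‖φ‖ = 1 → RCLike.re (φ x) = ‖φ‖ → ∀ δ : ℝ, 0 < δ →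
      ∃ φ' : E →L[𝕜] 𝕜, ‖φ' - φ‖ ≤ δ ∧ RCLike.re (φ' x) < ‖φ'‖) : IsDaugavet 𝕜 x := by
  have h := isNabla_iff.1 hx
  refine ⟨hx.1, ?_⟩
  rintro S ⟨φ, ε, hφ, hε, rfl⟩
  rw [sliceOf_closedBall]
  refine (supDistTwo_iff hx.1 fun y hy => hy.1).2 fun η hη => ?_
  obtain ⟨φ', h1, h2⟩ : ∃ φ' : E →L[𝕜] 𝕜, ‖φ' - φ‖ ≤ ε / 4 ∧ RCLike.re (φ' x) < ‖φ'‖ := by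
    by_cases h0 : RCLike.re (φ x) = ‖φ‖
    · exact H φ hφ h0 _ (by positivity)
    · exact ⟨φ, by simp; positivity, lt_of_le_of_ne (re_apply_le_norm φ hx.1.le) h0⟩
  -- The second entry of the minimum excludes `x` from the slice. The first leaves room for two
  -- losses of `ε / 4`, one in the norm and one in the value at `y`, when passing back to `φ`.
  obtain ⟨y, hy, h'⟩ := h.2 φ' (min (ε / 2) (‖φ'‖ - RCLike.re (φ' x))) η
    (lt_min (by positivity) (by linarith))
    (fun hm => by have := hm.2; have := min_le_right (ε / 2) (‖φ'‖ - RCLike.re (φ' x)); linarith)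
    hη
  refine ⟨y, ⟨hy.1, ?_⟩, h'⟩
  have a1 := hy.2
  have a2 := min_le_left (ε / 2) (‖φ'‖ - RCLike.re (φ' x))
  have a3 := re_apply_le_norm (φ' - φ) hy.1
  have a4 := norm_sub_norm_le φ φ'
  rw [norm_sub_rev] at a4
  simp only [sub_apply, map_sub] at a3
  linarith

/-- If `φ x = 1 = ‖φ‖`, then multiplying `φ` by `1 + iδ` raises the norm above 1 but keeps the real
part at `x` equal to 1. -/
theorem IsNabla.isDaugavet_of_I_ne_zero (hI : (RCLike.I : 𝕜) ≠ 0) {x : E} (hx : IsNabla 𝕜 x) :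
    IsDaugavet 𝕜 x := by
  refine hx.isDaugavet_of_perturb fun φ hφ h0 δ hδ => ?_
  have hn : ‖(RCLike.I : 𝕜)‖ = 1 := RCLike.norm_I_of_ne_zero hI
  refine ⟨φ + ((δ : 𝕜) * RCLike.I) • φ, ?_, ?_⟩
  · rw [add_sub_cancel_left, norm_smul, norm_mul, hn, hφ]
    simp [abs_of_pos hδ]
  · have hx1 : φ x = 1 := by
      have h1 : ‖φ x‖ ≤ 1 := hφ ▸ φ.unit_le_opNorm x hx.1.le
      have h2 : RCLike.re (φ x) = 1 := h0.trans hφ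
      have h3 := RCLike.norm_sq_eq_def (z := φ x)
      have h4 : RCLike.im (φ x) = 0 := by nlinarith [norm_nonneg (φ x)]
      apply RCLike.ext <;> simp [h2, h4]
    have h1 : φ + ((δ : 𝕜) * RCLike.I) • φ = (1 + (δ : 𝕜) * RCLike.I) • φ := by
      ext y
      simp [add_mul]
    have h2 := RCLike.norm_sq_eq_def (z := (1 + (δ : 𝕜) * RCLike.I))
    have h3 : RCLike.im (RCLike.I : 𝕜) = 1 := by
      simpa using congrArg RCLike.re ((RCLike.I_mul_I_ax (K := 𝕜)).resolve_left hI)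
    rw [h1, norm_smul, hφ, mul_one, smul_apply, hx1]
    simp [h3] at h2 ⊢
    nlinarith [norm_nonneg (1 + (δ : 𝕜) * RCLike.I)]

end Characterizations

/-! ### Transfer of the diametral notions along `ℓ_∞`-summands -/

/-- An isometric decomposition of `E` as the `ℓ_∞`-sum of `Y` and the kernel of `proj`. -/
structure MSummand (𝕜 E Y : Type*) [RCLike 𝕜] [NormedAddCommGroup E] [NormedSpace 𝕜 E]
    [NormedAddCommGroup Y] [NormedSpace 𝕜 Y] where
  proj : E →L[𝕜] Y
  incl : Y →L[𝕜] E
  proj_incl : ∀ y, proj (incl y) = y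
  norm_eq : ∀ e, ‖e‖ = max ‖proj e‖ ‖e - incl (proj e)‖

namespace MSummand

variable {𝕜 E Y : Type*} [RCLike 𝕜] [NormedAddCommGroup E] [NormedSpace 𝕜 E]
  [NormedAddCommGroup Y] [NormedSpace 𝕜 Y] (M : MSummand 𝕜 E Y)

theorem norm_proj_le (e : E) : ‖M.proj e‖ ≤ ‖e‖ := by
  rw [M.norm_eq e]; exact le_max_left _ _

theorem norm_compl_le (e : E) : ‖e - M.incl (M.proj e)‖ ≤ ‖e‖ := by
  rw [M.norm_eq e]; exact le_max_right _ _

theorem norm_incl (y : Y) : ‖M.incl y‖ = ‖y‖ := by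
  rw [M.norm_eq, M.proj_incl, sub_self, norm_zero, max_eq_left (norm_nonneg _)]

/-- Replace the component of `e` in `Y` by `y`. -/
def glue (y : Y) (e : E) : E := M.incl y + (e - M.incl (M.proj e))

@[simp] theorem proj_glue (y : Y) (e : E) : M.proj (M.glue y e) = y := by
  simp [glue, M.proj_incl]

theorem glue_proj (e : E) : M.glue (M.proj e) e = e := by
  simp [glue]

theorem norm_glue_le {y : Y} {e : E} (hy : ‖y‖ ≤ 1) (he : ‖e‖ ≤ 1) : ‖M.glue y e‖ ≤ 1 := by
  rw [M.norm_eq, proj_glue]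
  refine max_le hy ?_
  rw [glue, add_sub_cancel_left]
  exact (M.norm_compl_le e).trans he

/-- A point `e` almost norming `φ` is almost optimal in its complementary component. Exchanging its
`Y`-component for `y` then costs little more than the deficit of `y`. -/
theorem lift {φ : E →L[𝕜] 𝕜} {ε : ℝ} {y : Y} (hy : y ∈ halfBall (φ.comp M.incl) ε) :
    ∃ e ∈ halfBall φ ε, M.proj e = y := by
  obtain ⟨hy1, hy2⟩ := hy
  -- The tolerance is the amount by which `y` exceeds the threshold of its own slice.
  obtain ⟨e, he1, he2⟩ := halfBall_nonempty φ
    (ε := RCLike.re (φ.comp M.incl y) - (‖φ.comp M.incl‖ - ε)) (by linarith)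
  refine ⟨M.glue y e, ⟨M.norm_glue_le hy1 he1, ?_⟩, by simp⟩
  have := re_apply_le_norm (φ.comp M.incl) ((M.norm_proj_le e).trans he1)
  simp only [ContinuousLinearMap.comp_apply, glue, map_add, map_sub] at *
  linarith

theorem norm_comp_proj (φ : Y →L[𝕜] 𝕜) : ‖φ.comp M.proj‖ = ‖φ‖ := by
  apply le_antisymm
  · refine ContinuousLinearMap.opNorm_le_bound _ (norm_nonneg _) fun e => ?_
    exact (φ.le_opNorm _).trans (mul_le_mul_of_nonneg_left (M.norm_proj_le e) (norm_nonneg _))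
  · refine ContinuousLinearMap.opNorm_le_bound _ (norm_nonneg _) fun y => ?_
    simpa [M.proj_incl, M.norm_incl] using (φ.comp M.proj).le_opNorm (M.incl y)

theorem mem_halfBall_comp_proj {φ : Y →L[𝕜] 𝕜} {ε : ℝ} {e : E} :
    e ∈ halfBall (φ.comp M.proj) ε ↔ ‖e‖ ≤ 1 ∧ M.proj e ∈ halfBall φ ε := by
  simp only [halfBall, Set.mem_ofPred_eq, M.norm_comp_proj, ContinuousLinearMap.comp_apply]
  exact ⟨fun h => ⟨h.1, (M.norm_proj_le e).trans h.1, h.2⟩, fun h => ⟨h.1, h.2.2⟩⟩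

theorem norm_proj_eq_one {x : E} (hx : ‖x‖ = 1) (hx' : ‖x - M.incl (M.proj x)‖ < 1) :
    ‖M.proj x‖ = 1 := by
  have := M.norm_eq x
  rw [hx] at this
  rcases max_choice ‖M.proj x‖ ‖x - M.incl (M.proj x)‖ with h | h <;> rw [h] at this <;> linarith

/-- With `z` the complementary component of `x`, complementary distances are at most `‖z‖ + 1 = 2 -
(1 - ‖z‖)`. A larger distance can only come from `Y`. -/
theorem far_proj {x e : E} {η : ℝ} (he : ‖e‖ ≤ 1)
    (h : 2 - min η (1 - ‖x - M.incl (M.proj x)‖) < ‖x - e‖) :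
    2 - η < ‖M.proj x - M.proj e‖ := by
  have h1 := min_le_left η (1 - ‖x - M.incl (M.proj x)‖)
  have h2 := min_le_right η (1 - ‖x - M.incl (M.proj x)‖)
  have h3 := M.norm_eq (x - e)
  have h4 : ‖x - e - M.incl (M.proj (x - e))‖ ≤ ‖x - M.incl (M.proj x)‖ + 1 := by
    have : x - e - M.incl (M.proj (x - e)) =
      (x - M.incl (M.proj x)) - (e - M.incl (M.proj e)) := by simp only [map_sub]; abel
    rw [this]
    refine (norm_sub_le _ _).trans ?_
    have := (M.norm_compl_le e).trans he
    linarith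
  rw [← map_sub]
  rcases max_choice ‖M.proj (x - e)‖ ‖x - e - M.incl (M.proj (x - e))‖ with h | h <;>
    rw [h] at h3 <;> linarith

theorem far_of_proj {x e : E} {y : Y} {η : ℝ} (he : M.proj e = y) (h : 2 - η < ‖M.proj x - y‖) :
    2 - η < ‖x - e‖ := by
  rw [← he, ← map_sub] at h
  exact h.trans_le (M.norm_proj_le _)

variable {M} {x : E}

theorem isDaugavet_of_proj (hx : ‖x‖ = 1) (h : IsDaugavet 𝕜 (M.proj x)) : IsDaugavet 𝕜 x := by
  rw [isDaugavet_iff] at h ⊢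
  refine ⟨hx, fun φ ε η hε hη => ?_⟩
  obtain ⟨y, hy, hf⟩ := h.2 (φ.comp M.incl) ε η hε hη
  obtain ⟨e, he, rfl⟩ := M.lift hy
  exact ⟨e, he, M.far_of_proj rfl hf⟩

theorem isDaugavet_iff_proj (hx : ‖x‖ = 1) (hx' : ‖x - M.incl (M.proj x)‖ < 1) :
    IsDaugavet 𝕜 x ↔ IsDaugavet 𝕜 (M.proj x) := by
  refine ⟨fun h => ?_, isDaugavet_of_proj hx⟩
  rw [isDaugavet_iff] at h ⊢
  refine ⟨M.norm_proj_eq_one hx hx', fun φ ε η hε hη => ?_⟩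
  obtain ⟨e, he, hf⟩ := h.2 (φ.comp M.proj) ε _ hε (lt_min hη (sub_pos.2 hx'))
  exact ⟨_, (M.mem_halfBall_comp_proj.1 he).2, M.far_proj he.1 hf⟩

/-- Freezing the complementary component of `x` turns a slice around `x` into a slice of `Y` around
`M.proj x`; the new depth is what the frozen component leaves over. -/
theorem mem_halfBall_comp_incl {φ : E →L[𝕜] 𝕜} {ε : ℝ} (hm : x ∈ halfBall φ ε) :
    M.proj x ∈ halfBall (φ.comp M.incl)
        (RCLike.re (φ (x - M.incl (M.proj x))) + ‖φ.comp M.incl‖ - ‖φ‖ + ε) ∧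
      0 < RCLike.re (φ (x - M.incl (M.proj x))) + ‖φ.comp M.incl‖ - ‖φ‖ + ε := by
  have h1 := (M.norm_proj_le x).trans hm.1
  have h2 := re_apply_le_norm (φ.comp M.incl) h1
  have h3 := hm.2
  simp only [ContinuousLinearMap.comp_apply, map_sub, halfBall, Set.mem_ofPred_eq] at *
  exact ⟨⟨h1, by linarith⟩, by linarith⟩

theorem glue_mem_halfBall {φ : E →L[𝕜] 𝕜} {ε : ℝ} {y : Y} (hm : x ∈ halfBall φ ε)
    (hy : y ∈ halfBall (φ.comp M.incl)
      (RCLike.re (φ (x - M.incl (M.proj x))) + ‖φ.comp M.incl‖ - ‖φ‖ + ε)) :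
    M.glue y x ∈ halfBall φ ε := by
  refine ⟨M.norm_glue_le hy.1 hm.1, ?_⟩
  have := hy.2
  simp only [ContinuousLinearMap.comp_apply, glue, map_add] at *
  linarith

theorem isDelta_of_proj (hx : ‖x‖ = 1) (h : IsDelta 𝕜 (M.proj x)) : IsDelta 𝕜 x := by
  rw [isDelta_iff] at h ⊢
  refine ⟨hx, fun φ ε η hε hm hη => ?_⟩
  obtain ⟨h1, h2⟩ := mem_halfBall_comp_incl (M := M) hm
  obtain ⟨y, hy, hf⟩ := h.2 _ _ η h2 h1 hη
  exact ⟨_, glue_mem_halfBall hm hy, M.far_of_proj (by simp) hf⟩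

theorem isDelta_iff_proj (hx : ‖x‖ = 1) (hx' : ‖x - M.incl (M.proj x)‖ < 1) :
    IsDelta 𝕜 x ↔ IsDelta 𝕜 (M.proj x) := by
  refine ⟨fun h => ?_, isDelta_of_proj hx⟩
  rw [isDelta_iff] at h ⊢
  refine ⟨M.norm_proj_eq_one hx hx', fun φ ε η hε hm hη => ?_⟩
  obtain ⟨e, he, hf⟩ := h.2 (φ.comp M.proj) ε _ hε (M.mem_halfBall_comp_proj.2 ⟨hx.le, hm⟩)
    (lt_min hη (sub_pos.2 hx'))
  exact ⟨_, (M.mem_halfBall_comp_proj.1 he).2, M.far_proj he.1 hf⟩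

theorem proj_sum_smul (M : MSummand 𝕜 E Y) {n : ℕ} (c : Fin n → ℝ) (e : Fin n → E) :
    M.proj (∑ i, ((c i : ℝ) : 𝕜) • e i) = ∑ i, ((c i : ℝ) : 𝕜) • M.proj (e i) := by
  simp

theorem isCcsDaugavet_iff_proj (hx : ‖x‖ = 1) (hx' : ‖x - M.incl (M.proj x)‖ < 1) :
    IsCcsDaugavet 𝕜 x ↔ IsCcsDaugavet 𝕜 (M.proj x) := by
  rw [isCcsDaugavet_iff, isCcsDaugavet_iff]
  refine ⟨fun h => ⟨M.norm_proj_eq_one hx hx', fun n c φ ε η hc hc1 hε hη => ?_⟩,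
    fun h => ⟨hx, fun n c φ ε η hc hc1 hε hη => ?_⟩⟩
  · obtain ⟨e, he, hf⟩ := h.2 n c (fun i => (φ i).comp M.proj) ε _ hc hc1 hε
      (lt_min hη (sub_pos.2 hx'))
    refine ⟨fun i => M.proj (e i), fun i => (M.mem_halfBall_comp_proj.1 (he i)).2, ?_⟩
    rw [← M.proj_sum_smul]
    exact M.far_proj (norm_le_of_mem_combo (𝕜 := 𝕜) hc hc1 (fun i y hy => hy.1) ⟨e, he, rfl⟩) hf
  · obtain ⟨y, hy, hf⟩ := h.2 n c (fun i => (φ i).comp M.incl) ε η hc hc1 hε hη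
    choose e he hey using fun i => M.lift (hy i)
    refine ⟨e, he, M.far_of_proj ?_ hf⟩
    rw [M.proj_sum_smul]
    simp only [hey]

/-- Points of `Y` that average to `M.proj x` are all given the complementary component of `x`; as
the weights sum to one, the glued points average to `x`. -/
theorem isCcsDelta_proj (hx' : ‖x - M.incl (M.proj x)‖ < 1) (h : IsCcsDelta 𝕜 x) :
    IsCcsDelta 𝕜 (M.proj x) := by
  rw [isCcsDelta_iff] at h ⊢
  have hx := h.1
  refine ⟨M.norm_proj_eq_one hx hx', fun n c φ ε η hc hc1 hε hm hη => ?_⟩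
  obtain ⟨y, hy, hxy⟩ := hm
  obtain ⟨e, he, hf⟩ := h.2 n c (fun i => (φ i).comp M.proj) ε _ hc hc1 hε
    ⟨fun i => M.glue (y i) x, fun i => M.mem_halfBall_comp_proj.2
      ⟨M.norm_glue_le (hy i).1 hx.le, by simpa using hy i⟩, by
        simp only [glue, smul_add, Finset.sum_add_distrib, ← map_smul, ← map_sum, ← hxy]
        rw [← Finset.sum_smul, ← RCLike.ofReal_sum, hc1, RCLike.ofReal_one, one_smul,
          add_sub_cancel]⟩
    (lt_min hη (sub_pos.2 hx'))
  refine ⟨fun i => M.proj (e i), fun i => (M.mem_halfBall_comp_proj.1 (he i)).2, ?_⟩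
  rw [← M.proj_sum_smul]
  exact M.far_proj (norm_le_of_mem_combo (𝕜 := 𝕜) hc hc1 (fun i y hy => hy.1) ⟨e, he, rfl⟩) hf

theorem norm_le_one_of_mem_isWeaklyOpenInBall {W : Set E} (hW : IsWeaklyOpenInBall 𝕜 W) {y : E}
    (hy : y ∈ W) : ‖y‖ ≤ 1 := by
  obtain ⟨-, U, -, rfl⟩ := hW
  simpa using hy.1

theorem isWeaklyOpenInBall_preimage_proj (M : MSummand 𝕜 E Y) {W : Set Y}
    (hW : IsWeaklyOpenInBall 𝕜 W) :
    IsWeaklyOpenInBall 𝕜 (Metric.closedBall (0 : E) 1 ∩ M.proj ⁻¹' W) := by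
  obtain ⟨⟨y, hy⟩, U, hU, rfl⟩ := hW
  refine ⟨⟨M.incl y, ?_, ?_⟩, WeakSpace.map M.proj ⁻¹' U,
    hU.preimage (WeakSpace.map M.proj).continuous, ?_⟩
  · simpa [M.norm_incl] using hy.1
  · simpa [M.proj_incl] using hy
  · ext e
    simp only [Set.mem_inter_iff, mem_closedBall_zero_iff, Set.mem_preimage, and_congr_right_iff]
    exact fun he => ⟨fun h => h.2, fun h => ⟨(M.norm_proj_le e).trans he, h⟩⟩

/-- With one point of `W` fixed, gluing is an affine weakly continuous map of the `Y`-component, so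
it suffices to move inside `Y`. -/
theorem isWeaklyOpenInBall_preimage_glue (M : MSummand 𝕜 E Y) {W : Set E}
    (hW : IsWeaklyOpenInBall 𝕜 W) {e : E} (he : e ∈ W) :
    IsWeaklyOpenInBall 𝕜 (Metric.closedBall (0 : Y) 1 ∩ (fun y => M.glue y e) ⁻¹' W) := by
  have he1 := norm_le_one_of_mem_isWeaklyOpenInBall hW he
  obtain ⟨-, U, hU, rfl⟩ := hW
  refine ⟨⟨M.proj e, ?_, ?_⟩, (fun w => WeakSpace.map M.incl w +
    toWeakSpace 𝕜 E (e - M.incl (M.proj e))) ⁻¹' U,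
    hU.preimage ((WeakSpace.map M.incl).continuous.add continuous_const), ?_⟩
  · simpa using (M.norm_proj_le e).trans he1
  · simpa [M.glue_proj] using he
  · ext y
    simp only [Set.mem_inter_iff, mem_closedBall_zero_iff, Set.mem_preimage, and_congr_right_iff]
    exact fun hy => ⟨fun h => h.2, fun h => ⟨M.norm_glue_le hy he1, h⟩⟩

theorem isSuperDaugavet_iff_proj (hx : ‖x‖ = 1) (hx' : ‖x - M.incl (M.proj x)‖ < 1) :
    IsSuperDaugavet 𝕜 x ↔ IsSuperDaugavet 𝕜 (M.proj x) := by
  have hPx := M.norm_proj_eq_one hx hx'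
  refine ⟨fun h => ⟨hPx, fun W hW => ?_⟩, fun h => ⟨hx, fun W hW => ?_⟩⟩
  · refine (supDistTwo_iff hPx fun y => norm_le_one_of_mem_isWeaklyOpenInBall hW).2 fun η hη => ?_
    have hW' := M.isWeaklyOpenInBall_preimage_proj hW
    obtain ⟨e, he, hf⟩ := (supDistTwo_iff hx fun y =>
      norm_le_one_of_mem_isWeaklyOpenInBall hW').1 (h.2 _ hW') _ (lt_min hη (sub_pos.2 hx'))
    exact ⟨_, he.2, M.far_proj (norm_le_one_of_mem_isWeaklyOpenInBall hW' he) hf⟩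
  · refine (supDistTwo_iff hx fun y => norm_le_one_of_mem_isWeaklyOpenInBall hW).2 fun η hη => ?_
    obtain ⟨e, he⟩ := hW.1
    have hW' := M.isWeaklyOpenInBall_preimage_glue hW he
    obtain ⟨y, hy, hf⟩ := (supDistTwo_iff hPx fun y =>
      norm_le_one_of_mem_isWeaklyOpenInBall hW').1 (h.2 _ hW') η hη
    exact ⟨_, hy.2, M.far_of_proj (by simp) hf⟩

theorem isSuperDelta_iff_proj (hx : ‖x‖ = 1) (hx' : ‖x - M.incl (M.proj x)‖ < 1) :
    IsSuperDelta 𝕜 x ↔ IsSuperDelta 𝕜 (M.proj x) := by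
  have hPx := M.norm_proj_eq_one hx hx'
  refine ⟨fun h => ⟨hPx, fun W hW hm => ?_⟩, fun h => ⟨hx, fun W hW hm => ?_⟩⟩
  · refine (supDistTwo_iff hPx fun y => norm_le_one_of_mem_isWeaklyOpenInBall hW).2 fun η hη => ?_
    have hW' := M.isWeaklyOpenInBall_preimage_proj hW
    obtain ⟨e, he, hf⟩ := (supDistTwo_iff hx fun y =>
      norm_le_one_of_mem_isWeaklyOpenInBall hW').1 (h.2 _ hW' ⟨by simp [hx], hm⟩) _
        (lt_min hη (sub_pos.2 hx'))
    exact ⟨_, he.2, M.far_proj (norm_le_one_of_mem_isWeaklyOpenInBall hW' he) hf⟩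
  · refine (supDistTwo_iff hx fun y => norm_le_one_of_mem_isWeaklyOpenInBall hW).2 fun η hη => ?_
    have hW' := M.isWeaklyOpenInBall_preimage_glue hW hm
    obtain ⟨y, hy, hf⟩ := (supDistTwo_iff hPx fun y =>
      norm_le_one_of_mem_isWeaklyOpenInBall hW').1
        (h.2 _ hW' ⟨by simp [hPx], by simpa [M.glue_proj] using hm⟩) η hη
    exact ⟨_, hy.2, M.far_of_proj (by simp) hf⟩

/-- Off a proper `ℓ_∞`-summand on which `x` takes its norm, every functional can be perturbed, so
`∇` points are Daugavet. -/
theorem isDaugavet_of_isNabla (hx' : ‖x - M.incl (M.proj x)‖ < 1) {w : E} (hw0 : w ≠ 0)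
    (hw : M.proj w = 0) (h : IsNabla 𝕜 x) : IsDaugavet 𝕜 x := by
  refine h.isDaugavet_of_perturb fun φ _ h0 δ hδ => ?_
  set z := x - M.incl (M.proj x) with hz
  have hPz : M.proj z = 0 := by simp [hz, M.proj_incl]
  have hball : ∀ v : E, M.proj v = 0 → ‖v‖ ≤ 1 → ‖M.incl (M.proj x) + v‖ ≤ 1 := by
    intro v hv hv1
    have := M.norm_glue_le ((M.norm_proj_le x).trans h.1.le) hv1
    simpa [glue, hv] using this
  obtain ⟨ψ, hψ, hψw⟩ := exists_norm_eq_one_dual (𝕜 := 𝕜) (x := ((‖w‖⁻¹ : ℝ) : 𝕜) • w) (by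
    rw [norm_smul, RCLike.norm_ofReal, abs_of_pos (inv_pos.2 (norm_pos_iff.2 hw0)),
      inv_mul_cancel₀ (by simpa using hw0)])
  set w' := ((‖w‖⁻¹ : ℝ) : 𝕜) • w with hw'
  have hw'1 : ‖w'‖ ≤ 1 := by
    rw [hw', norm_smul, RCLike.norm_ofReal, abs_of_pos (inv_pos.2 (norm_pos_iff.2 hw0)),
      inv_mul_cancel₀ (by simpa using hw0)]
  have hPw' : M.proj w' = 0 := by simp [hw', hw]
  -- Because `‖z‖ < 1`, the point `x + (1 - ‖z‖) v` is still in the ball, and `re φ` is already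
  -- maximal at `x`.
  have hkill : ∀ v : E, M.proj v = 0 → ‖v‖ ≤ 1 → RCLike.re (φ v) ≤ 0 := by
    intro v hv hv1
    have h1 := hball (z + ((1 - ‖z‖ : ℝ) : 𝕜) • v) (by simp [hPz, hv]) (by
      refine (norm_add_le _ _).trans ?_
      rw [norm_smul, RCLike.norm_ofReal, abs_of_pos (sub_pos.2 hx')]
      nlinarith [norm_nonneg z])
    have h2 := re_apply_le_norm φ h1
    rw [← add_assoc, hz, add_sub_cancel, ← hz, map_add, map_smul, map_add, h0, smul_eq_mul,
      RCLike.re_ofReal_mul] at h2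
    nlinarith
  have hφz : RCLike.re (φ z) = 0 := by
    refine le_antisymm (hkill z hPz hx'.le) ?_
    simpa using hkill (-z) (by simp [hPz]) (by simpa using hx'.le)
  have hφw : RCLike.re (φ w') = 0 := by
    refine le_antisymm (hkill w' hPw' hw'1) ?_
    simpa using hkill (-w') (by simp [hPw']) (by simpa using hw'1)
  set Q : E →L[𝕜] E := ContinuousLinearMap.id 𝕜 E - M.incl.comp M.proj with hQ
  have hQe : ∀ e, Q e = e - M.incl (M.proj e) := fun e => rfl
  have hQn : ‖ψ.comp Q‖ ≤ 1 := by
    refine ContinuousLinearMap.opNorm_le_bound _ zero_le_one fun e => ?_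
    rw [one_mul, ContinuousLinearMap.comp_apply, hQe]
    exact (ψ.le_of_opNorm_le hψ.le _).trans (by simpa using M.norm_compl_le e)
  -- Changing the complementary component from `z` to `w'` does not affect `re φ`. The added term
  -- contributes `δ` at `w'` but at most `δ * ‖z‖ < δ` at `x`.
  refine ⟨φ + (δ : 𝕜) • ψ.comp Q, ?_, ?_⟩
  · rw [add_sub_cancel_left, norm_smul, RCLike.norm_ofReal, abs_of_pos hδ]
    nlinarith
  · have h1 := re_apply_le_norm (φ + (δ : 𝕜) • ψ.comp Q) (hball w' hPw' hw'1)
    have h2 : φ (M.incl (M.proj x)) = φ x - φ z := by simp [hz]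
    have h3 : RCLike.re (ψ z) ≤ ‖z‖ := (RCLike.re_le_norm _).trans
      ((ψ.le_of_opNorm_le hψ.le _).trans (by simp))
    simp only [add_apply, smul_apply, ContinuousLinearMap.comp_apply, hQe, map_add, map_sub, hPw',
      M.proj_incl, h2, smul_eq_mul, RCLike.re_ofReal_mul, hφw, hφz, hψw, map_zero, sub_zero,
      h0, RCLike.one_re] at h1 ⊢
    rw [← map_sub, ← map_sub, ← hz]
    nlinarith

/-- An isometric isomorphism is a summand with trivial complement. -/
def ofEquiv (e : E ≃ₗᵢ[𝕜] Y) : MSummand 𝕜 E Y where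
  proj := (e : E ≃L[𝕜] Y)
  incl := (e.symm : Y ≃L[𝕜] E)
  proj_incl y := by simp
  norm_eq x := by simp

/-- A summand with trivial complement is an isometric isomorphism. -/
def toEquiv (M : MSummand 𝕜 E Y) (h : ∀ e, M.incl (M.proj e) = e) : E ≃ₗᵢ[𝕜] Y where
  toFun := M.proj
  map_add' := map_add _
  map_smul' := map_smul _
  invFun := M.incl
  left_inv := h
  right_inv := M.proj_incl
  norm_map' e := by
    have := M.norm_eq e
    rw [h, sub_self, norm_zero, max_eq_left (norm_nonneg _)] at this
    exact this.symm

theorem toEquiv_apply (h : ∀ e, M.incl (M.proj e) = e) (e : E) : M.toEquiv h e = M.proj e := rfl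

end MSummand

/-! ### Invariance under isometric isomorphisms -/

section Equiv

variable {𝕜 E Y : Type*} [RCLike 𝕜] [NormedAddCommGroup E] [NormedSpace 𝕜 E]
  [NormedAddCommGroup Y] [NormedSpace 𝕜 Y] (e : E ≃ₗᵢ[𝕜] Y) {x : E}

theorem halfBall_comp_equiv {φ : Y →L[𝕜] 𝕜} {ε : ℝ} {x : E} :
    x ∈ halfBall (φ.comp ((e : E ≃L[𝕜] Y) : E →L[𝕜] Y)) ε ↔ e x ∈ halfBall φ ε := by
  refine (MSummand.ofEquiv e).mem_halfBall_comp_proj.trans ⟨fun h => h.2, fun h => ⟨?_, h⟩⟩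
  simpa using h.1

theorem isDaugavet_map_iff : IsDaugavet 𝕜 (e x) ↔ IsDaugavet 𝕜 x := by
  by_cases hx : ‖x‖ = 1
  · exact ((MSummand.ofEquiv e).isDaugavet_iff_proj hx (by simp [MSummand.ofEquiv])).symm
  · exact iff_of_false (fun h => hx (by simpa using h.1)) fun h => hx h.1

theorem isDelta_map_iff : IsDelta 𝕜 (e x) ↔ IsDelta 𝕜 x := by
  by_cases hx : ‖x‖ = 1
  · exact ((MSummand.ofEquiv e).isDelta_iff_proj hx (by simp [MSummand.ofEquiv])).symm
  · exact iff_of_false (fun h => hx (by simpa using h.1)) fun h => hx h.1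

theorem isSuperDaugavet_map_iff : IsSuperDaugavet 𝕜 (e x) ↔ IsSuperDaugavet 𝕜 x := by
  by_cases hx : ‖x‖ = 1
  · exact ((MSummand.ofEquiv e).isSuperDaugavet_iff_proj hx (by simp [MSummand.ofEquiv])).symm
  · exact iff_of_false (fun h => hx (by simpa using h.1)) fun h => hx h.1

theorem isSuperDelta_map_iff : IsSuperDelta 𝕜 (e x) ↔ IsSuperDelta 𝕜 x := by
  by_cases hx : ‖x‖ = 1
  · exact ((MSummand.ofEquiv e).isSuperDelta_iff_proj hx (by simp [MSummand.ofEquiv])).symm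
  · exact iff_of_false (fun h => hx (by simpa using h.1)) fun h => hx h.1

theorem isCcsDaugavet_map_iff : IsCcsDaugavet 𝕜 (e x) ↔ IsCcsDaugavet 𝕜 x := by
  by_cases hx : ‖x‖ = 1
  · exact ((MSummand.ofEquiv e).isCcsDaugavet_iff_proj hx (by simp [MSummand.ofEquiv])).symm
  · exact iff_of_false (fun h => hx (by simpa using h.1)) fun h => hx h.1

/-- The one-sided transfer is applied to `e` and to its inverse. -/
theorem isCcsDelta_map_iff : IsCcsDelta 𝕜 (e x) ↔ IsCcsDelta 𝕜 x := by
  refine ⟨fun h => ?_, (MSummand.ofEquiv e).isCcsDelta_proj (by simp [MSummand.ofEquiv])⟩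
  simpa [MSummand.ofEquiv] using
    (MSummand.ofEquiv e.symm).isCcsDelta_proj (by simp [MSummand.ofEquiv]) h

theorem IsNabla.map (h : IsNabla 𝕜 x) : IsNabla 𝕜 (e x) := by
  rw [isNabla_iff] at h ⊢
  refine ⟨by simpa using h.1, fun φ ε η hε hm hη => ?_⟩
  obtain ⟨y, hy, hf⟩ := h.2 _ ε η hε (mt (halfBall_comp_equiv e (φ := φ)).1 hm) hη
  exact ⟨e y, (halfBall_comp_equiv e).1 hy, by rwa [← map_sub, e.norm_map]⟩

theorem isNabla_map_iff : IsNabla 𝕜 (e x) ↔ IsNabla 𝕜 x :=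
  ⟨fun h => by simpa using h.map e.symm, fun h => h.map e⟩

theorem IsDeltaP.map {p : ℝ} (hp : 0 < p) (h : IsDeltaP 𝕜 p x) : IsDeltaP 𝕜 p (e x) := by
  rw [isDeltaP_iff hp] at h ⊢
  refine ⟨by simpa using h.1, fun φ α η hα hm hη => ?_⟩
  obtain ⟨y, hy, hf⟩ := h.2 _ α η hα ((halfBall_comp_equiv e (φ := φ)).2 hm) hη
  exact ⟨e y, (halfBall_comp_equiv e).1 hy, by rwa [← map_sub, e.norm_map]⟩

theorem isDeltaP_map_iff {p : ℝ} (hp : 0 < p) : IsDeltaP 𝕜 p (e x) ↔ IsDeltaP 𝕜 p x :=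
  ⟨fun h => by simpa using h.map e.symm hp, fun h => h.map e hp⟩

end Equiv

/-! ### Finite `ℓ_∞`-powers -/

section Pi

variable {𝕜 X J : Type*} [RCLike 𝕜] [NormedAddCommGroup X] [NormedSpace 𝕜 X] [Fintype J]

/-- The `j`-th coordinate of a finite `ℓ_∞`-power. -/
noncomputable def MSummand.coord (𝕜 X : Type*) [RCLike 𝕜] [NormedAddCommGroup X] [NormedSpace 𝕜 X]
    [DecidableEq J] (j : J) : MSummand 𝕜 (J → X) X where
  proj := ContinuousLinearMap.proj j
  incl := ContinuousLinearMap.single 𝕜 (fun _ => X) j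
  proj_incl y := by simp
  norm_eq e := by
    apply le_antisymm
    · refine (pi_norm_le_iff_of_nonneg (by positivity)).2 fun i => ?_
      by_cases h : i = j
      · subst h; exact le_max_left _ _
      · refine le_max_of_le_right ?_
        have := norm_le_pi_norm (e - Pi.single j (e j)) i
        rwa [Pi.sub_apply, Pi.single_eq_of_ne h, sub_zero] at this
    · refine max_le (norm_le_pi_norm e j) ((pi_norm_le_iff_of_nonneg (norm_nonneg _)).2 fun i => ?_)
      by_cases h : i = j
      · subst h; simp
      · simpa [h] using norm_le_pi_norm e i

/-- The restriction of a functional on a finite `ℓ_∞`-power to the `j`-th factor. -/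
noncomputable def part [DecidableEq J] (φ : (J → X) →L[𝕜] 𝕜) (j : J) : X →L[𝕜] 𝕜 :=
  φ.comp (ContinuousLinearMap.single 𝕜 (fun _ => X) j)

theorem apply_eq_sum_part [DecidableEq J] (φ : (J → X) →L[𝕜] 𝕜) (v : J → X) :
    φ v = ∑ j, part φ j (v j) := by
  conv_lhs => rw [← Finset.univ_sum_single v, map_sum]
  rfl

/-- The ball of the power is the product of the balls, so all coordinates can be made almost norming
simultaneously. -/
theorem sum_norm_part_le [DecidableEq J] (φ : (J → X) →L[𝕜] 𝕜) : ∑ j, ‖part φ j‖ ≤ ‖φ‖ := by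
  refine le_of_forall_pos_le_add fun η hη => ?_
  have hN : 0 < (Fintype.card J + 1 : ℝ) := by positivity
  choose u hu1 hu2 using fun j => halfBall_nonempty (part φ j)
    (ε := η / (Fintype.card J + 1)) (by positivity)
  have h1 := re_apply_le_norm φ ((pi_norm_le_iff_of_nonneg zero_le_one).2 hu1)
  rw [apply_eq_sum_part, map_sum] at h1
  have h2 := Finset.sum_le_sum fun j (_ : j ∈ Finset.univ) => (hu2 j).le
  rw [Finset.sum_sub_distrib, Finset.sum_const, nsmul_eq_mul, Finset.card_univ] at h2
  have h3 : (Fintype.card J : ℝ) * (η / (Fintype.card J + 1)) ≤ η := by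
    rw [mul_div_assoc', div_le_iff₀ hN]
    nlinarith
  linarith

/-- The functional `∑ j, c j • φ j` on a finite `ℓ_∞`-power. -/
noncomputable def weighted (c : J → ℝ) (φ : J → X →L[𝕜] 𝕜) : (J → X) →L[𝕜] 𝕜 :=
  ∑ j, ((c j : ℝ) : 𝕜) • (φ j).comp (ContinuousLinearMap.proj j)

theorem weighted_apply (c : J → ℝ) (φ : J → X →L[𝕜] 𝕜) (v : J → X) :
    RCLike.re (weighted c φ v) = ∑ j, c j * RCLike.re (φ j (v j)) := by
  simp [weighted]

theorem norm_weighted {c : J → ℝ} (hc : ∀ j, 0 < c j) (φ : J → X →L[𝕜] 𝕜) :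
    ‖weighted c φ‖ = ∑ j, c j * ‖φ j‖ := by
  classical
  apply le_antisymm
  · refine (norm_sum_le _ _).trans (Finset.sum_le_sum fun j _ => ?_)
    rw [norm_smul, RCLike.norm_ofReal, abs_of_pos (hc j)]
    exact mul_le_mul_of_nonneg_left ((MSummand.coord 𝕜 X j).norm_comp_proj (φ j)).le (hc j).le
  · refine le_trans (Finset.sum_le_sum fun j _ => ?_) (sum_norm_part_le (weighted c φ))
    have : part (weighted c φ) j = ((c j : ℝ) : 𝕜) • φ j := by
      ext x
      simp [part, weighted, Pi.single_apply, apply_ite]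
    rw [this, norm_smul, RCLike.norm_ofReal, abs_of_pos (hc j)]

/-- If each coordinate of `v` stays away from a slice of the factor, then `v` stays away from a
slice of the `ℓ_∞`-power. -/
theorem exists_forall_norm_sub_le [Nonempty J] {v : J → X} {c α η : J → ℝ} {φ : J → X →L[𝕜] 𝕜}
    {β : ℝ} (hc : ∀ j, 0 < c j) (hη : ∀ j, 0 < η j) (hβ : ∀ j, β ≤ c j * α j)
    (h : ∀ j, ∀ y ∈ halfBall (φ j) (α j), ‖v j - y‖ ≤ 2 - η j) :
    ∃ δ : ℝ, 0 < δ ∧ ∀ u ∈ halfBall (weighted c φ) β, ‖v - u‖ ≤ 2 - δ := by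
  obtain ⟨j₀, hj₀⟩ := Finite.exists_min η
  refine ⟨η j₀, hη j₀, fun u hu => ?_⟩
  refine (pi_norm_le_iff_of_nonempty _).2 fun j => ?_
  have hu1 : ∀ i, ‖u i‖ ≤ 1 := fun i => (norm_le_pi_norm u i).trans hu.1
  refine (h j (u j) ⟨hu1 j, ?_⟩).trans (by linarith [hj₀ j])
  have h1 := hu.2
  rw [norm_weighted hc, weighted_apply] at h1
  -- All coordinate deficits are nonnegative, so each is bounded by the total, which is below `β ≤ c
  -- j * α j`.
  have h2 : c j * (‖φ j‖ - RCLike.re (φ j (u j))) ≤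
      ∑ i, c i * (‖φ i‖ - RCLike.re (φ i (u i))) :=
    Finset.single_le_sum (f := fun i => c i * (‖φ i‖ - RCLike.re (φ i (u i))))
      (fun i _ => mul_nonneg (hc i).le (sub_nonneg.2 (re_apply_le_norm (φ i) (hu1 i))))
      (Finset.mem_univ j)
  simp only [mul_sub, Finset.sum_sub_distrib] at h2
  nlinarith [hβ j, hc j]

/-- If every coordinate has a bad slice, the sum of the corresponding functionals, with the smallest
of the depths, defines a bad slice of the power. -/
theorem isDaugavet_pi_iff [Nonempty J] {v : J → X} (hv : ∀ j, ‖v j‖ = 1) :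
    IsDaugavet 𝕜 v ↔ ∃ j, IsDaugavet 𝕜 (v j) := by
  classical
  have hv1 : ‖v‖ = 1 := by
    apply le_antisymm
    · exact (pi_norm_le_iff_of_nonneg zero_le_one).2 fun j => (hv j).le
    · exact (hv (Classical.arbitrary J)).ge.trans (norm_le_pi_norm v _)
  constructor
  · intro h
    by_contra! hcon
    have key : ∀ j, ∃ (φ : X →L[𝕜] 𝕜) (ε η : ℝ), 0 < ε ∧ 0 < η ∧
        ∀ y ∈ halfBall φ ε, ‖v j - y‖ ≤ 2 - η := by
      intro j
      have := mt isDaugavet_iff.2 (hcon j)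
      push Not at this
      exact this (hv j)
    choose φ ε η hε hη hfar using key
    obtain ⟨j₀, hj₀⟩ := Finite.exists_min ε
    obtain ⟨δ, hδ, hδ'⟩ := exists_forall_norm_sub_le (c := fun _ => 1) (β := ε j₀)
      (fun _ => one_pos) hη (by simpa using hj₀) hfar
    obtain ⟨u, hu, hu'⟩ := (isDaugavet_iff.1 h).2 (weighted (fun _ => 1) φ) _ δ (hε j₀) hδ
    exact (hδ' u hu).not_gt hu'
  · rintro ⟨j, hj⟩
    exact MSummand.isDaugavet_of_proj (M := MSummand.coord 𝕜 X j) hv1 hj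

/-- Only positivity of the exponents is needed, so `p = 1` is covered for a single coordinate. -/
theorem exists_isDeltaP_of_isDelta_pi [Nonempty J] {v : J → X} (hv : ∀ j, ‖v j‖ = 1)
    (h : IsDelta 𝕜 v) {p : J → ℝ} (hp : ∀ j, 0 < p j) (hp1 : ∑ j, 1 / p j = 1) :
    ∃ j, IsDeltaP 𝕜 (p j) (v j) := by
  by_contra! hcon
  have key : ∀ j, ∃ (φ : X →L[𝕜] 𝕜) (α η : ℝ), 0 < α ∧ v j ∈ halfBall φ α ∧ 0 < η ∧
      ∀ y ∈ halfBall φ (p j * α), ‖v j - y‖ ≤ 2 - η := by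
    intro j
    have := mt (isDeltaP_iff (hp j)).2 (hcon j)
    push Not at this
    exact this (hv j)
  choose φ α η hα hm hη hfar using key
  -- These weights scale every bad slice of depth `p j * α j` to depth 1, while the deficit of `v j`
  -- becomes less than `1 / p j`; hence `v` lies in the combined slice of depth 1.
  have hc : ∀ j, 0 < 1 / (p j * α j) := fun j => one_div_pos.2 (mul_pos (hp j) (hα j))
  obtain ⟨δ, hδ, hδ'⟩ := exists_forall_norm_sub_le (c := fun j => 1 / (p j * α j)) (β := 1)
    hc hη (fun j => (one_div_mul_cancel (mul_pos (hp j) (hα j)).ne').ge) hfar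
  have hmem : v ∈ halfBall (weighted (fun j => 1 / (p j * α j)) φ) 1 := by
    refine ⟨h.1.le, ?_⟩
    rw [norm_weighted hc, weighted_apply]
    refine lt_of_eq_of_lt (congrArg _ hp1.symm) ?_
    rw [← Finset.sum_sub_distrib]
    refine Finset.sum_lt_sum_of_nonempty Finset.univ_nonempty fun j _ => ?_
    have h1 : 1 / p j = 1 / (p j * α j) * α j := by
      have := (hp j).ne'
      have := (hα j).ne'
      field_simp
    rw [h1, ← mul_sub]
    exact mul_lt_mul_of_pos_left (hm j).2 (hc j)
  obtain ⟨u, hu, hu'⟩ := (isDelta_iff.1 h).2 _ _ δ one_pos hmem hδ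
  exact (hδ' u hu).not_gt hu'

/-- The exponents are read off from the given slice as total depth divided by the share of each
coordinate. Some coordinate then admits a far point in a slice deep enough to lift. -/
theorem isDelta_pi_of_isDeltaP {v : J → X} (hv1 : ‖v‖ = 1)
    (hJ : 2 ≤ Fintype.card J)
    (h : ∀ p : J → ℝ, (∀ j, 1 < p j) → ∑ j, 1 / p j = 1 → ∃ j, IsDeltaP 𝕜 (p j) (v j)) :
    IsDelta 𝕜 v := by
  classical
  refine isDelta_iff.2 ⟨hv1, fun φ α η hα hm hη => ?_⟩
  have hvj : ∀ j, ‖v j‖ ≤ 1 := fun j => (norm_le_pi_norm v j).trans hv1.le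
  set a : J → ℝ := fun j => ‖part φ j‖ - RCLike.re (part φ j (v j)) with ha
  have ha0 : ∀ j, 0 ≤ a j := fun j => sub_nonneg.2 (re_apply_le_norm _ (hvj j))
  have hsum : ∑ j, a j < α := by
    have h1 := hm.2
    rw [apply_eq_sum_part, map_sum] at h1
    have h2 := sum_norm_part_le φ
    rw [ha, Finset.sum_sub_distrib]
    linarith
  have hN : (2 : ℝ) ≤ Fintype.card J := by exact_mod_cast hJ
  -- The unused depth is spread evenly, making all shares `a j + s` positive with sum `α`; a second
  -- coordinate then forces `α / (a j + s) > 1`.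
  set s : ℝ := (α - ∑ j, a j) / Fintype.card J with hs
  have hs0 : 0 < s := div_pos (by linarith) (by linarith)
  have hsα : ∑ j, (a j + s) = α := by
    rw [Finset.sum_add_distrib, Finset.sum_const, nsmul_eq_mul, Finset.card_univ, hs,
      mul_div_cancel₀ _ (by linarith)]
    ring
  have hpos : ∀ j, 0 < a j + s := fun j => by linarith [ha0 j]
  obtain ⟨j, hj⟩ := h (fun j => α / (a j + s)) (fun j => by
      rw [one_lt_div (hpos j), ← hsα]
      have : Nontrivial J := Fintype.one_lt_card_iff_nontrivial.1 hJ
      obtain ⟨i, hi⟩ := exists_ne j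
      exact Finset.single_lt_sum (f := fun j => a j + s) hi (Finset.mem_univ j)
        (Finset.mem_univ i) (hpos i) fun k _ _ => (hpos k).le)
    (by simp only [one_div_div]; rw [← Finset.sum_div, hsα, div_self hα.ne'])
  obtain ⟨y, hy, hf⟩ := ((isDeltaP_iff (div_pos hα (hpos j))).1 hj).2 (part φ j) (a j + s) η
    (hpos j) ⟨hvj j, by simp only [ha]; linarith⟩ hη
  rw [div_mul_cancel₀ _ (hpos j).ne'] at hy
  obtain ⟨u, hu, hu'⟩ := (MSummand.coord 𝕜 X j).lift (φ := φ) hy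
  exact ⟨u, hu, (MSummand.coord 𝕜 X j).far_of_proj hu' hf⟩

theorem isDelta_pi_iff [Nonempty J] {v : J → X} (hv : ∀ j, ‖v j‖ = 1) :
    IsDelta 𝕜 v ↔ (∃ j, IsDelta 𝕜 (v j)) ∨ (2 ≤ Fintype.card J ∧
      ∀ p : J → ℝ, (∀ j, 1 < p j) → ∑ j, 1 / p j = 1 → ∃ j, IsDeltaP 𝕜 (p j) (v j)) := by
  classical
  have hv1 : ‖v‖ = 1 := by
    apply le_antisymm
    · exact (pi_norm_le_iff_of_nonneg zero_le_one).2 fun j => (hv j).le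
    · exact (hv (Classical.arbitrary J)).ge.trans (norm_le_pi_norm v _)
  constructor
  · intro h
    rcases Nat.lt_or_ge (Fintype.card J) 2 with hJ | hJ
    · left
      have : Fintype.card J = 1 := by have := Fintype.card_pos (α := J); omega
      obtain ⟨j, hj⟩ := exists_isDeltaP_of_isDelta_pi hv h (p := fun _ => 1) (fun _ => one_pos)
        (by simp [this])
      exact ⟨j, isDeltaP_one_iff.1 hj⟩
    · exact .inr ⟨hJ, fun p hp => exists_isDeltaP_of_isDelta_pi hv h fun j =>
        one_pos.trans (hp j)⟩
  · rintro (⟨j, hj⟩ | ⟨hJ, h⟩)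
    · exact MSummand.isDelta_of_proj (M := MSummand.coord 𝕜 X j) hv1 hj
    · exact isDelta_pi_of_isDeltaP hv1 hJ h

/-- A single coordinate missing its slice keeps `v` out of the combined slice, so one failure of ∇
together with failures of Daugavet elsewhere suffices. Conversely, if `v` misses a slice of `φ`,
some part of `φ` fails to be normed at its coordinate, and ∇ applies there. -/
theorem isNabla_pi_iff [Nonempty J] {v : J → X} (hv : ∀ j, ‖v j‖ = 1) :
    IsNabla 𝕜 v ↔ (∀ j, IsNabla 𝕜 (v j)) ∨ ∃ j, IsDaugavet 𝕜 (v j) := by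
  classical
  have hv1 : ‖v‖ = 1 := by
    apply le_antisymm
    · exact (pi_norm_le_iff_of_nonneg zero_le_one).2 fun j => (hv j).le
    · exact (hv (Classical.arbitrary J)).ge.trans (norm_le_pi_norm v _)
  constructor
  · intro h
    by_contra! hcon
    obtain ⟨⟨j₁, hj₁⟩, hcon⟩ := hcon
    have key : ∀ j, ∃ (φ : X →L[𝕜] 𝕜) (ε η : ℝ), 0 < ε ∧ 0 < η ∧
        (j = j₁ → v j ∉ halfBall φ ε) ∧ ∀ y ∈ halfBall φ ε, ‖v j - y‖ ≤ 2 - η := by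
      intro j
      by_cases hj : j = j₁
      · subst hj
        have := mt isNabla_iff.2 hj₁
        push Not at this
        obtain ⟨φ, ε, η, hε, hm, hη, h⟩ := this (hv j)
        exact ⟨φ, ε, η, hε, hη, fun _ => hm, h⟩
      · have := mt isDaugavet_iff.2 (hcon j)
        push Not at this
        obtain ⟨φ, ε, η, hε, hη, h⟩ := this (hv j)
        exact ⟨φ, ε, η, hε, hη, fun h => absurd h hj, h⟩
    choose φ ε η hε hη hm hfar using key
    obtain ⟨j₀, hj₀⟩ := Finite.exists_min ε
    obtain ⟨δ, hδ, hδ'⟩ := exists_forall_norm_sub_le (c := fun _ => 1) (β := ε j₀)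
      (fun _ => one_pos) hη (by simpa using hj₀) hfar
    have hnot : v ∉ halfBall (weighted (fun _ => 1) φ) (ε j₀) := by
      rintro ⟨-, h2⟩
      rw [norm_weighted fun _ => one_pos, weighted_apply] at h2
      refine hm j₁ rfl ⟨(hv j₁).le, ?_⟩
      have h3 := Finset.single_le_sum (f := fun i => ‖φ i‖ - RCLike.re (φ i (v i)))
        (fun i _ => sub_nonneg.2 (re_apply_le_norm (φ i) (hv i).le)) (Finset.mem_univ j₁)
      rw [Finset.sum_sub_distrib] at h3
      simp only [one_mul] at h2
      linarith [hj₀ j₁]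
    obtain ⟨u, hu, hu'⟩ := (isNabla_iff.1 h).2 _ _ δ (hε j₀) hnot hδ
    exact (hδ' u hu).not_gt hu'
  · rintro (h | ⟨j, hj⟩)
    · refine isNabla_iff.2 ⟨hv1, fun φ ε η hε hm hη => ?_⟩
      have : ∃ j, RCLike.re (part φ j (v j)) < ‖part φ j‖ := by
        by_contra! hcon
        refine hm ⟨hv1.le, ?_⟩
        have h1 : ‖φ‖ ≤ ∑ j, ‖part φ j‖ := by
          refine φ.opNorm_le_bound (by positivity) fun u => ?_
          rw [apply_eq_sum_part, Finset.sum_mul]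
          refine (norm_sum_le _ _).trans (Finset.sum_le_sum fun j _ => ?_)
          exact (ContinuousLinearMap.le_opNorm _ _).trans
            (mul_le_mul_of_nonneg_left (norm_le_pi_norm u j) (norm_nonneg _))
        have h2 := Finset.sum_le_sum fun j (_ : j ∈ Finset.univ) => hcon j
        rw [apply_eq_sum_part, map_sum]
        linarith
      obtain ⟨j, hj⟩ := this
      obtain ⟨y, hy, hf⟩ := (isNabla_iff.1 (h j)).2 (part φ j)
        -- The depth is cut down so that the slice of the factor misses `v j`.
        (min ε (‖part φ j‖ - RCLike.re (part φ j (v j)))) η (lt_min hε (by linarith))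
        (fun hm => by
          have := hm.2
          have := min_le_right ε (‖part φ j‖ - RCLike.re (part φ j (v j)))
          linarith) hη
      obtain ⟨u, hu, hu'⟩ := (MSummand.coord 𝕜 X j).lift (φ := φ) (ε := ε) (y := y)
        ⟨hy.1, lt_of_le_of_lt (sub_le_sub_left (min_le_left _ _) _) hy.2⟩
      exact ⟨u, hu, (MSummand.coord 𝕜 X j).far_of_proj hu' hf⟩
    · exact (MSummand.isDaugavet_of_proj (M := MSummand.coord 𝕜 X j) hv1 hj).isNabla

end Pi

/-! ### Orthogonal M-projections and ccs-Daugavet points -/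

section MProjections

variable {𝕜 E ι : Type*} [RCLike 𝕜] [NormedAddCommGroup E] [NormedSpace 𝕜 E]

/-- By orthogonality each `Q m` splits its own summand off the sum, so norms combine by maximum and
not by addition. -/
theorem norm_sum_smul_mprojection_le {Q : ι → E →L[𝕜] E}
    (hQ : ∀ m e, ‖e‖ = max ‖Q m e‖ ‖e - Q m e‖) (hQi : ∀ m e, Q m (Q m e) = Q m e)
    (hQd : ∀ m k, m ≠ k → ∀ e, Q m (Q k e) = 0) {θ : ι → ℝ} (hθ : ∀ m, |θ m| ≤ 1) (h : E)
    (s : Finset ι) : ‖∑ m ∈ s, ((θ m : ℝ) : 𝕜) • Q m h‖ ≤ ‖h‖ := by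
  classical
  induction s using Finset.induction_on with
  | empty => simp
  | insert m s hm ih =>
    rw [Finset.sum_insert hm]
    have h0 : Q m (∑ k ∈ s, ((θ k : ℝ) : 𝕜) • Q k h) = 0 := by
      rw [map_sum]
      refine Finset.sum_eq_zero fun k hk => ?_
      rw [map_smul, hQd m k (fun h => hm (h ▸ hk)), smul_zero]
    rw [hQ m, map_add, map_smul, hQi, h0, add_zero, add_sub_cancel_left]
    refine max_le ?_ ih
    rw [norm_smul, RCLike.norm_ofReal]
    have : ‖Q m h‖ ≤ ‖h‖ := by rw [hQ m h]; exact le_max_left _ _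
    nlinarith [hθ m, norm_nonneg (Q m h), abs_nonneg (θ m)]

/-- Signs turn the sum into one value of `φ`. The bound is independent of the number of projections,
which makes the later averaging work. -/
theorem sum_abs_re_mprojection_le [Fintype ι] {Q : ι → E →L[𝕜] E}
    (hQ : ∀ m e, ‖e‖ = max ‖Q m e‖ ‖e - Q m e‖) (hQi : ∀ m e, Q m (Q m e) = Q m e)
    (hQd : ∀ m k, m ≠ k → ∀ e, Q m (Q k e) = 0) (φ : E →L[𝕜] 𝕜) (h : E) :
    ∑ m, |RCLike.re (φ (Q m h))| ≤ ‖φ‖ * ‖h‖ := by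
  set θ : ι → ℝ := fun m => if 0 ≤ RCLike.re (φ (Q m h)) then 1 else -1 with hθ
  have h1 : ∑ m, |RCLike.re (φ (Q m h))| = RCLike.re (φ (∑ m, ((θ m : ℝ) : 𝕜) • Q m h)) := by
    rw [map_sum, map_sum]
    refine Finset.sum_congr rfl fun m _ => ?_
    rw [map_smul, smul_eq_mul, RCLike.re_ofReal_mul]
    simp only [hθ]
    split_ifs with h
    · rw [abs_of_nonneg h, one_mul]
    · rw [abs_of_neg (not_le.1 h), neg_one_mul]
  rw [h1]
  refine (RCLike.re_le_norm _).trans ((φ.le_opNorm _).trans ?_)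
  refine mul_le_mul_of_nonneg_left (norm_sum_smul_mprojection_le hQ hQi hQd ?_ h _)
    (norm_nonneg _)
  intro m
  simp only [hθ]
  split_ifs <;> simp

/-- A point which is almost normed by arbitrarily many mutually orthogonal `M`-projections is
ccs-Daugavet. -/
theorem isCcsDaugavet_of_mprojections {x : E} (hx : ‖x‖ = 1)
    (H : ∀ (η : ℝ) (N : ℕ), 0 < η → ∃ Q : Fin N → E →L[𝕜] E,
      (∀ m e, ‖e‖ = max ‖Q m e‖ ‖e - Q m e‖) ∧ (∀ m e, Q m (Q m e) = Q m e) ∧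
      (∀ m k, m ≠ k → ∀ e, Q m (Q k e) = 0) ∧ ∀ m, 1 - η < ‖Q m x‖) :
    IsCcsDaugavet 𝕜 x := by
  refine isCcsDaugavet_iff.2 ⟨hx, fun n c φ ε η hc hc1 hε hη => ?_⟩
  have : Nonempty (Fin n) := by
    by_contra h0
    rw [not_nonempty_iff] at h0
    simp at hc1
  choose g hg1 hg2 using fun k => halfBall_nonempty (φ k) (hε k)
  obtain ⟨k₀, hk₀⟩ := Finite.exists_min fun k => RCLike.re (φ k (g k)) - (‖φ k‖ - ε k)
  set s := RCLike.re (φ k₀ (g k₀)) - (‖φ k₀‖ - ε k₀) with hs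
  have hs0 : 0 < s := sub_pos.2 (hg2 k₀)
  obtain ⟨N, hN⟩ := exists_nat_gt ((∑ k, ‖φ k‖ * ‖g k + x‖) / s)
  rw [div_lt_iff₀ hs0] at hN
  obtain ⟨Q, hQ, hQi, hQd, hQx⟩ := H (η / 2) N (by positivity)
  -- Averaging over `m`: the double sum is less than `N * s`, where `s` is the least margin by which
  -- a `g k` lies in its slice.
  obtain ⟨m, hm⟩ : ∃ m, ∑ k, |RCLike.re (φ k (Q m (g k + x)))| < s := by
    by_contra! hcon
    have h1 := Finset.sum_le_sum fun m (_ : m ∈ Finset.univ) => hcon m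
    rw [Finset.sum_comm] at h1
    have h2 := Finset.sum_le_sum fun k (_ : k ∈ Finset.univ) =>
      sum_abs_re_mprojection_le hQ hQi hQd (φ k) (g k + x)
    simp only [Finset.sum_const, Finset.card_univ, Fintype.card_fin, nsmul_eq_mul] at h1
    linarith
  -- This is `g k` with its `m`-th component replaced by `-Q m x`.
  refine ⟨fun k => g k - Q m (g k + x), fun k => ⟨?_, ?_⟩, ?_⟩
  · have h1 : Q m (g k - Q m (g k + x)) = - Q m x := by
      rw [map_sub, hQi, map_add]; abel
    rw [hQ m, h1, norm_neg]
    refine max_le ?_ ?_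
    · rw [← hx, hQ m x]; exact le_max_left _ _
    · have : g k - Q m (g k + x) - -Q m x = g k - Q m (g k) := by rw [map_add]; abel
      rw [this]
      refine le_trans ?_ (hg1 k)
      rw [hQ m (g k)]; exact le_max_right _ _
  · have h1 := Finset.single_le_sum (f := fun k => |RCLike.re (φ k (Q m (g k + x)))|)
      (fun k _ => abs_nonneg _) (Finset.mem_univ k)
    have h2 := le_abs_self (RCLike.re (φ k (Q m (g k + x))))
    have h3 := hk₀ k
    simp only [map_sub] at *
    linarith
  · have h1 : Q m (x - ∑ k, ((c k : ℝ) : 𝕜) • (g k - Q m (g k + x))) = (2 : 𝕜) • Q m x := by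
      have : ∀ k, Q m (g k - Q m (g k + x)) = - Q m x := fun k => by
        rw [map_sub, hQi, map_add]; abel
      simp only [map_sub (Q m) x, map_sum, map_smul, this, ← Finset.sum_smul,
        ← RCLike.ofReal_sum, hc1, RCLike.ofReal_one, one_smul, sub_neg_eq_add, two_smul]
    have h2 : ‖Q m (x - ∑ k, ((c k : ℝ) : 𝕜) • (g k - Q m (g k + x)))‖ ≤
        ‖x - ∑ k, ((c k : ℝ) : 𝕜) • (g k - Q m (g k + x))‖ := by
      rw [hQ m (x - _)]; exact le_max_left _ _
    rw [h1, norm_smul, RCLike.norm_ofNat] at h2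
    linarith [hQx m]

end MProjections

/-! ### Multiplication by indicators in `L_∞(μ, X)` and the first two assertions -/

section Linf

variable {𝕜 X Ω : Type*} [RCLike 𝕜] [NormedAddCommGroup X] [NormedSpace 𝕜 X]
  [MeasurableSpace Ω] {μ : Measure Ω}

theorem aestronglyMeasurable_of_aefsm {g : Ω → X} (hg : AEFinStronglyMeasurable g μ) :
    AEStronglyMeasurable g μ :=
  ⟨hg.mk g, hg.finStronglyMeasurable_mk.stronglyMeasurable, hg.ae_eq_mk⟩

/-- The class in `L_∞(μ, X)` of an essentially bounded function. -/
noncomputable def toLinf (𝕜 : Type*) [RCLike 𝕜] [NormedSpace 𝕜 X] (g : Ω → X)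
    (hg : AEFinStronglyMeasurable g μ) (hb : ∃ C : ℝ, ∀ᵐ ω ∂μ, ‖g ω‖ ≤ C) : Linf 𝕜 X μ :=
  ⟨(memLp_top_of_bound (aestronglyMeasurable_of_aefsm hg) hb.choose hb.choose_spec).toLp,
    aefsm_congr hg (MemLp.coeFn_toLp _)⟩

theorem coe_toLinf (g : Ω → X) (hg : AEFinStronglyMeasurable g μ)
    (hb : ∃ C : ℝ, ∀ᵐ ω ∂μ, ‖g ω‖ ≤ C) : (toLinf 𝕜 g hg hb : Lp X ∞ μ) =ᵐ[μ] g :=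
  MemLp.coeFn_toLp
    (memLp_top_of_bound (aestronglyMeasurable_of_aefsm hg) hb.choose hb.choose_spec)

theorem Linf.ext_ae {f g : Linf 𝕜 X μ} (h : (f : Lp X ∞ μ) =ᵐ[μ] (g : Lp X ∞ μ)) : f = g :=
  Subtype.ext (Lp.ext h)

theorem Linf.coe_add (f g : Linf 𝕜 X μ) : ∀ᵐ ω ∂μ, ((f + g : Linf 𝕜 X μ) : Lp X ∞ μ) ω =
    (f : Lp X ∞ μ) ω + (g : Lp X ∞ μ) ω :=
  Lp.coeFn_add (f : Lp X ∞ μ) (g : Lp X ∞ μ)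

theorem Linf.coe_sub (f g : Linf 𝕜 X μ) : ∀ᵐ ω ∂μ, ((f - g : Linf 𝕜 X μ) : Lp X ∞ μ) ω =
    (f : Lp X ∞ μ) ω - (g : Lp X ∞ μ) ω :=
  Lp.coeFn_sub (f : Lp X ∞ μ) (g : Lp X ∞ μ)

theorem Linf.coe_smul (c : 𝕜) (f : Linf 𝕜 X μ) : ∀ᵐ ω ∂μ, ((c • f : Linf 𝕜 X μ) : Lp X ∞ μ) ω =
    c • (f : Lp X ∞ μ) ω :=
  Lp.coeFn_smul c (f : Lp X ∞ μ)

theorem Linf.coe_zero : ∀ᵐ ω ∂μ, ((0 : Linf 𝕜 X μ) : Lp X ∞ μ) ω = 0 :=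
  Lp.coeFn_zero X ∞ μ

theorem Linf.ae_norm_le (f : Linf 𝕜 X μ) : ∀ᵐ ω ∂μ, ‖(f : Lp X ∞ μ) ω‖ ≤ ‖f‖ := by
  have h1 : ‖f‖ = (eLpNormEssSup (f : Lp X ∞ μ) μ).toReal := by
    rw [Submodule.coe_norm, Lp.norm_def, eLpNorm_exponent_top]
  have h2 : eLpNormEssSup (f : Lp X ∞ μ) μ ≠ ∞ := by
    rw [← eLpNorm_exponent_top]; exact (Lp.memLp (f : Lp X ∞ μ)).2.ne
  filter_upwards [ae_le_eLpNormEssSup (f := ((f : Lp X ∞ μ) : Ω → X)) (μ := μ)] with ω hω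
  rw [h1, ← toReal_enorm]
  exact ENNReal.toReal_mono h2 hω

theorem Linf.norm_le_iff (f : Linf 𝕜 X μ) {C : ℝ} (hC : 0 ≤ C) :
    ‖f‖ ≤ C ↔ ∀ᵐ ω ∂μ, ‖(f : Lp X ∞ μ) ω‖ ≤ C := by
  refine ⟨fun h => (Linf.ae_norm_le f).mono fun ω hω => hω.trans h, fun h => ?_⟩
  rw [Submodule.coe_norm, Lp.norm_def, eLpNorm_exponent_top]
  exact ENNReal.toReal_le_of_le_ofReal hC (eLpNormEssSup_le_of_ae_bound h)

theorem coe_restr (f : Linf 𝕜 X μ) (S : Set Ω) :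
    (restr f S : Lp X ∞ (μ.restrict S)) =ᵐ[μ.restrict S] (f : Lp X ∞ μ) :=
  MemLp.coeFn_toLp ((Lp.memLp (f : Lp X ∞ μ)).restrict S)

theorem norm_restr_le_iff (f : Linf 𝕜 X μ) {S : Set Ω} (hS : MeasurableSet S) {C : ℝ}
    (hC : 0 ≤ C) : ‖restr f S‖ ≤ C ↔ ∀ᵐ ω ∂μ, ω ∈ S → ‖(f : Lp X ∞ μ) ω‖ ≤ C := by
  rw [Linf.norm_le_iff _ hC, ← ae_restrict_iff' hS]
  refine Filter.eventually_congr ?_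
  filter_upwards [coe_restr f S] with ω hω
  rw [hω]

theorem norm_restr_le (f : Linf 𝕜 X μ) {S : Set Ω} (hS : MeasurableSet S) :
    ‖restr f S‖ ≤ ‖f‖ :=
  (norm_restr_le_iff f hS (norm_nonneg _)).2 ((Linf.ae_norm_le f).mono fun _ h _ => h)

theorem aefsm_indicator {g : Ω → X} (hg : AEFinStronglyMeasurable g μ) {T : Set Ω}
    (hT : MeasurableSet T) : AEFinStronglyMeasurable (T.indicator g) μ := by
  classical
  obtain ⟨k, hk, hgk⟩ := hg
  obtain ⟨hk1, t, ht, ht0, hσ⟩ :=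
    finStronglyMeasurable_iff_stronglyMeasurable_and_exists_set_sigmaFinite.1 hk
  refine ⟨T.indicator k, finStronglyMeasurable_iff_stronglyMeasurable_and_exists_set_sigmaFinite.2
    ⟨hk1.indicator hT, t, ht, fun x hx => ?_, hσ⟩, ?_⟩
  · simp [ht0 x hx]
  · filter_upwards [hgk] with ω hω
    simp [Set.indicator_apply, hω]

/-- Multiplication by the indicator function of a measurable set, as a map. -/
noncomputable def cutFun {T : Set Ω} (hT : MeasurableSet T) (f : Linf 𝕜 X μ) : Linf 𝕜 X μ :=
  toLinf 𝕜 (T.indicator (f : Lp X ∞ μ)) (aefsm_indicator f.2 hT)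
    ⟨‖f‖, (Linf.ae_norm_le f).mono fun _ hω => (norm_indicator_le_norm_self _ _).trans hω⟩

theorem coe_cutFun {T : Set Ω} (hT : MeasurableSet T) (f : Linf 𝕜 X μ) :
    ∀ᵐ ω ∂μ, (cutFun hT f : Lp X ∞ μ) ω = T.indicator (f : Lp X ∞ μ) ω :=
  coe_toLinf _ _ _

/-- Multiplication by the indicator function of a measurable set. -/
noncomputable def cut {T : Set Ω} (hT : MeasurableSet T) : Linf 𝕜 X μ →L[𝕜] Linf 𝕜 X μ :=
  LinearMap.mkContinuous
    { toFun := cutFun hT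
      map_add' := fun f g => by
        classical
        apply Linf.ext_ae
        filter_upwards [coe_cutFun hT (f + g), coe_cutFun hT f, coe_cutFun hT g,
          Linf.coe_add f g, Linf.coe_add (cutFun hT f) (cutFun hT g)] with ω h1 h2 h3 h4 h5
        rw [h1, h5, h2, h3]
        simp only [Set.indicator_apply, h4]
        split_ifs <;> simp
      map_smul' := fun c f => by
        classical
        apply Linf.ext_ae
        filter_upwards [coe_cutFun hT (c • f), coe_cutFun hT f, Linf.coe_smul c f,
          Linf.coe_smul c (cutFun hT f)] with ω h1 h2 h3 h4
        rw [h1, RingHom.id_apply, h4, h2]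
        simp only [Set.indicator_apply, h3]
        split_ifs <;> simp } 1
    (fun f => by
      rw [one_mul, LinearMap.coe_mk, AddHom.coe_mk, Linf.norm_le_iff _ (norm_nonneg f)]
      filter_upwards [coe_cutFun hT f, Linf.ae_norm_le f] with ω h1 h2
      rw [h1]
      exact (norm_indicator_le_norm_self _ _).trans h2)

theorem coe_cut {T : Set Ω} (hT : MeasurableSet T) (f : Linf 𝕜 X μ) :
    ∀ᵐ ω ∂μ, (cut hT f : Lp X ∞ μ) ω = T.indicator (f : Lp X ∞ μ) ω :=
  coe_cutFun hT f

theorem norm_cut_le_iff {T : Set Ω} (hT : MeasurableSet T) (f : Linf 𝕜 X μ) {C : ℝ}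
    (hC : 0 ≤ C) : ‖cut hT f‖ ≤ C ↔ ∀ᵐ ω ∂μ, ω ∈ T → ‖(f : Lp X ∞ μ) ω‖ ≤ C := by
  classical
  rw [Linf.norm_le_iff _ hC]
  refine Filter.eventually_congr ?_
  filter_upwards [coe_cut hT f] with ω hω
  rw [hω, Set.indicator_apply]
  split_ifs with h <;> simp [h, hC]

theorem norm_cut {T : Set Ω} (hT : MeasurableSet T) (f : Linf 𝕜 X μ) :
    ‖cut hT f‖ = ‖restr f T‖ := by
  apply le_antisymm
  · exact (norm_cut_le_iff hT f (norm_nonneg _)).2 ((norm_restr_le_iff f hT (norm_nonneg _)).1 le_rfl)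
  · exact (norm_restr_le_iff f hT (norm_nonneg _)).2 ((norm_cut_le_iff hT f (norm_nonneg _)).1 le_rfl)

theorem norm_eq_max_cut {T : Set Ω} (hT : MeasurableSet T) (f : Linf 𝕜 X μ) :
    ‖f‖ = max ‖cut hT f‖ ‖f - cut hT f‖ := by
  classical
  apply le_antisymm
  · rw [Linf.norm_le_iff _ (by positivity)]
    filter_upwards [coe_cut hT f, Linf.coe_sub f (cut hT f), Linf.ae_norm_le (cut hT f),
      Linf.ae_norm_le (f - cut hT f)] with ω h1 h2 h3 h4
    by_cases hω : ω ∈ T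
    · rw [h1, Set.indicator_of_mem hω] at h3
      exact le_max_of_le_left h3
    · rw [h2, h1, Set.indicator_of_notMem hω, sub_zero] at h4
      exact le_max_of_le_right h4
  · refine max_le ?_ ?_
    · rw [norm_cut]; exact norm_restr_le f hT
    · rw [Linf.norm_le_iff _ (norm_nonneg _)]
      filter_upwards [coe_cut hT f, Linf.coe_sub f (cut hT f), (Linf.ae_norm_le f)] with ω h1 h2 h3
      rw [h2, h1, Set.indicator_apply]
      split_ifs
      · simp
      · rwa [sub_zero]

theorem cut_cut_self {T : Set Ω} (hT : MeasurableSet T) (f : Linf 𝕜 X μ) :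
    cut hT (cut hT f) = cut hT f := by
  classical
  apply Linf.ext_ae
  filter_upwards [coe_cut hT (cut hT f), coe_cut hT f] with ω h1 h2
  rw [h1, Set.indicator_apply, h2, Set.indicator_apply]
  split_ifs <;> rfl

theorem cut_cut_of_aedisjoint {S T : Set Ω} (hS : MeasurableSet S) (hT : MeasurableSet T)
    (h : AEDisjoint μ S T) (f : Linf 𝕜 X μ) : cut hS (cut hT f) = 0 := by
  classical
  apply Linf.ext_ae
  have h0 : ∀ᵐ ω ∂μ, ω ∉ S ∩ T := measure_eq_zero_iff_ae_notMem.1 h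
  filter_upwards [coe_cut hS (cut hT f), coe_cut hT f, Linf.coe_zero (𝕜 := 𝕜) (X := X) (μ := μ), h0]
    with ω h1 h2 h3 h4
  rw [h1, h3, Set.indicator_apply, h2, Set.indicator_apply]
  split_ifs with h5 h6
  · exact absurd ⟨h5, h6⟩ h4
  · rfl
  · rfl

/-- A function which is almost normed on arbitrarily many disjoint sets is ccs-Daugavet. -/
theorem isCcsDaugavet_of_almost_norming_sets {f : Linf 𝕜 X μ} (hf : ‖f‖ = 1)
    (H : ∀ (η : ℝ) (N : ℕ), 0 < η → ∃ T : Fin N → Set Ω, (∀ m, MeasurableSet (T m)) ∧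
      (∀ m k, m ≠ k → AEDisjoint μ (T m) (T k)) ∧ ∀ m, 1 - η < ‖restr f (T m)‖) :
    IsCcsDaugavet 𝕜 f := by
  refine isCcsDaugavet_of_mprojections hf fun η N hη => ?_
  obtain ⟨T, hT, hd, hn⟩ := H η N hη
  exact ⟨fun m => cut (hT m), fun m => norm_eq_max_cut (hT m), fun m => cut_cut_self (hT m),
    fun m k hmk => cut_cut_of_aedisjoint _ _ (hd m k hmk), fun m => by rw [norm_cut]; exact hn m⟩

/-- A set of positive finite measure that is not an atom splits into two parts of positive measure;
one is kept and the other is split further. -/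
theorem IsAtomless.exists_disjoint {T : Set Ω} (hT : MeasurableSet T) (h0 : 0 < μ T)
    (hfin : μ T < ∞) (ha : IsAtomless μ T) (N : ℕ) : ∃ S : Fin N → Set Ω,
      (∀ m, MeasurableSet (S m) ∧ S m ⊆ T ∧ 0 < μ (S m)) ∧ ∀ m k, m ≠ k → Disjoint (S m) (S k) := by
  induction N generalizing T with
  | zero => exact ⟨fun _ => ∅, fun m => m.elim0, fun m => m.elim0⟩
  | succ N ih =>
    have := ha T subset_rfl
    simp only [IsAtom, not_and, not_forall, not_or] at this
    obtain ⟨B, hB, hBT, hB0, hB1⟩ := this hT h0 hfin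
    obtain ⟨S, hS, hd⟩ := ih (hT.diff hB) (pos_iff_ne_zero.2 hB1)
      ((measure_mono Set.sdiff_subset).trans_lt hfin) fun C hC => ha C (hC.trans Set.sdiff_subset)
    have hBS : ∀ m, Disjoint B (S m) := fun m =>
      Set.disjoint_sdiff_right.mono_right (hS m).2.1
    refine ⟨Fin.cons B S, fun m => ?_, fun m k => ?_⟩
    · refine Fin.cases ⟨hB, hBT, pos_iff_ne_zero.2 hB0⟩ (fun i => ?_) m
      exact ⟨(hS i).1, (hS i).2.1.trans Set.sdiff_subset, (hS i).2.2⟩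
    · refine Fin.cases ?_ (fun i => ?_) m <;> refine Fin.cases ?_ (fun j => ?_) k
      · simp
      · exact fun _ => hBS j
      · exact fun _ => (hBS i).symm
      · exact fun h => hd i j fun h' => h (by rw [h'])

theorem lt_norm_restr (f : Linf 𝕜 X μ) {S : Set Ω} (hS : MeasurableSet S) (h0 : 0 < μ S) {r : ℝ}
    (h : ∀ᵐ ω ∂μ, ω ∈ S → r < ‖(f : Lp X ∞ μ) ω‖) : r < ‖restr f S‖ := by
  by_contra! hcon
  have h1 := (norm_restr_le_iff f hS (norm_nonneg _)).1 le_rfl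
  refine h0.ne' (measure_eq_zero_iff_ae_notMem.2 ?_)
  filter_upwards [h, h1] with ω h2 h3 h4
  linarith [h2 h4, h3 h4]

/-- The set where `f` is larger than `r` in norm, up to a null set. -/
theorem exists_measurableSet_lt_norm (f : Linf 𝕜 X μ) (r : ℝ) : ∃ G : Set Ω, MeasurableSet G ∧
    ∀ᵐ ω ∂μ, ω ∈ G ↔ r < ‖(f : Lp X ∞ μ) ω‖ := by
  have h := aestronglyMeasurable_of_aefsm f.2
  refine ⟨{ω | r < ‖h.mk _ ω‖}, h.stronglyMeasurable_mk.norm.measurable measurableSet_Ioi, ?_⟩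
  filter_upwards [h.ae_eq_mk] with ω hω
  rw [hω]

/-- A set of positive measure on which a function in `L_∞(μ, X)` does not vanish contains a set of
positive finite measure. -/
theorem exists_finite_part (f : Linf 𝕜 X μ) {S : Set Ω} (hS : MeasurableSet S)
    (h : ¬ ∀ᵐ ω ∂μ, ω ∈ S → (f : Lp X ∞ μ) ω = 0) : HasFinitePart μ S := by
  have h1 := aefsm_restrict f.2 S
  obtain ⟨s, hs, h2, h3⟩ := h1.exists_measurableSet_measure_pos_lt_top
    (fun h' => h ((ae_restrict_iff' hS).1 h'))
  rw [Measure.restrict_apply hs] at h2 h3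
  exact ⟨s ∩ S, hs.inter hS, Set.inter_subset_right, h2, h3⟩

theorem isCcsDaugavet_of_hasAtomlessNormingSet {f : Linf 𝕜 X μ} (hf : ‖f‖ = 1)
    (h : HasAtomlessNormingSet f) : IsCcsDaugavet 𝕜 f := by
  obtain ⟨S, hS, hS0, hSa, hSn⟩ := h
  refine isCcsDaugavet_of_almost_norming_sets hf fun η N hη => ?_
  -- The maximum with 0 ensures that `f` does not vanish on `G`, even for large `η`.
  obtain ⟨G, hG, hGf⟩ := exists_measurableSet_lt_norm f (max 0 (1 - η))
  obtain ⟨T, hT, hTs, hT0, hTfin⟩ : HasFinitePart μ (S ∩ G) := by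
    refine exists_finite_part f (hS.inter hG) fun h0 => ?_
    have : ‖restr f S‖ ≤ max 0 (1 - η) := by
      rw [norm_restr_le_iff f hS (le_max_left _ _)]
      filter_upwards [h0, hGf] with ω h1 h2 h3
      by_contra! h4
      have := h1 ⟨h3, h2.2 h4⟩
      rw [this, norm_zero] at h4
      exact (le_max_left _ _).not_gt h4
    rw [hSn] at this
    rcases le_max_iff.1 this with h | h <;> linarith
  obtain ⟨R, hR, hd⟩ := IsAtomless.exists_disjoint hT hT0 hTfin
    (fun B hB => hSa B (hB.trans (hTs.trans Set.inter_subset_left))) N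
  refine ⟨R, fun m => (hR m).1, fun m k hmk => (hd m k hmk).aedisjoint, fun m => ?_⟩
  refine lt_norm_restr f (hR m).1 (hR m).2.2 ?_
  filter_upwards [hGf] with ω h1 h2
  exact lt_of_le_of_lt (le_max_right _ _) (h1.1 (hTs ((hR m).2.1 h2)).2)

/-- The intersection is null or of full measure in each atom, and full in both means equality up to
a null set. -/
theorem IsAtom.aedisjoint {A B : Set Ω} (hA : IsAtom μ A) (hB : IsAtom μ B)
    (h : ¬ A =ᵐ[μ] B) : AEDisjoint μ A B := by
  rcases hA.2.2.2 (A ∩ B) (hA.1.inter hB.1) Set.inter_subset_left with h1 | h1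
  · exact h1
  rcases hB.2.2.2 (A ∩ B) (hA.1.inter hB.1) Set.inter_subset_right with h2 | h2
  · exact h2
  refine absurd (ae_eq_set.2 ⟨?_, ?_⟩) h
  · simpa using h1
  · simpa using h2

theorem IsAtomEnumeration.aedisjoint {I : Type*} {A : I → Set Ω} (hA : IsAtomEnumeration μ A)
    {i j : I} (h : i ≠ j) : AEDisjoint μ (A i) (A j) :=
  (hA.1 i).aedisjoint (hA.1 j) fun h' => h (hA.2.1 i j h')

theorem isCcsDaugavet_of_infinite_atoms {I : Type*} {A : I → Set Ω}
    (hA : IsAtomEnumeration μ A) {f : Linf 𝕜 X μ} (hf : ‖f‖ = 1)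
    (h : HasInfinitelyManyAlmostNormingAtoms A f) : IsCcsDaugavet 𝕜 f := by
  refine isCcsDaugavet_of_almost_norming_sets hf fun η N hη => ?_
  -- The factor 2 cancels the half in the threshold `1 - ε / 2`.
  have hinf := h (2 * η) (by positivity)
  refine ⟨fun m => A (hinf.natEmbedding _ m), fun m => (hA.1 _).1, fun m k hmk => ?_, fun m => ?_⟩
  · refine hA.aedisjoint fun h => hmk ?_
    exact Fin.ext ((hinf.natEmbedding _).injective (Subtype.ext h))
  · have : 1 - 2 * η / 2 < ‖restr f (A (hinf.natEmbedding _ m))‖ := (hinf.natEmbedding _ m).2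
    refine lt_of_le_of_lt (le_of_eq ?_) this
    ring

end Linf

/-! ### Atoms: essential values and the induced `ℓ_∞`-summand -/

section StepFun

variable {X Ω J : Type*} [NormedAddCommGroup X] [Fintype J]

/-- The function with the value `v j` on `A j`. -/
noncomputable def stepFun (A : J → Set Ω) (v : J → X) (ω : Ω) : X :=
  ∑ j, (A j).indicator (fun _ => v j) ω

theorem stepFun_of_notMem {A : J → Set Ω} (v : J → X) {ω : Ω} (h : ω ∉ ⋃ j, A j) :
    stepFun A v ω = 0 :=
  Finset.sum_eq_zero fun j _ =>
    Set.indicator_of_notMem (fun hj => h (Set.mem_iUnion.2 ⟨j, hj⟩)) _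

end StepFun

section Atoms

variable {𝕜 X Ω : Type*} [RCLike 𝕜] [NormedAddCommGroup X] [NormedSpace 𝕜 X]
  [MeasurableSpace Ω] {μ : Measure Ω}

theorem IsAtom.exists_mem_of_ae {A : Set Ω} (hA : IsAtom μ A) {P : Ω → Prop}
    (h : ∀ᵐ ω ∂μ, ω ∈ A → P ω) : ∃ ω ∈ A, P ω := by
  by_contra! hcon
  refine hA.2.1.ne' (measure_eq_zero_iff_ae_notMem.2 ?_)
  filter_upwards [h] with ω h1 h2
  exact hcon ω h2 (h1 h2)

theorem IsAtom.restrict {A B : Set Ω} (hA : IsAtom μ A) (hAB : A ⊆ B) :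
    IsAtom (μ.restrict B) A := by
  have h : ∀ C ⊆ A, MeasurableSet C → μ.restrict B C = μ C := fun C hC hCm => by
    rw [Measure.restrict_apply hCm, Set.inter_eq_left.2 (hC.trans hAB)]
  refine ⟨hA.1, ?_, ?_, fun C hC hCA => ?_⟩
  · rw [h A subset_rfl hA.1]; exact hA.2.1
  · rw [h A subset_rfl hA.1]; exact hA.2.2.1
  · rw [h C hCA hC, h _ Set.sdiff_subset (hA.1.diff hC)]
    exact hA.2.2.2 C hC hCA

/-- Each fibre is null or of full measure in the atom, and the finitely many fibres cannot all be
null. -/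
theorem IsAtom.ae_const_simpleFunc {Y : Type*} {A : Set Ω} (hA : IsAtom μ A)
    (s : SimpleFunc Ω Y) :
    ∃ c, ∀ᵐ ω ∂μ, ω ∈ A → s ω = c := by
  by_contra! hcon
  have h : ∀ c, ∀ᵐ ω ∂μ, ω ∈ A → s ω ≠ c := by
    intro c
    rcases hA.2.2.2 (A ∩ s ⁻¹' {c}) (hA.1.inter (s.measurableSet_fiber c))
      Set.inter_subset_left with h1 | h1
    · filter_upwards [measure_eq_zero_iff_ae_notMem.1 h1] with ω h2 h3 h4
      exact h2 ⟨h3, h4⟩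
    · refine absurd ?_ (hcon c)
      filter_upwards [measure_eq_zero_iff_ae_notMem.1 h1] with ω h2 h3
      exact h2 ⟨h3.1, fun h4 => h3.2 h4.2⟩
  obtain ⟨ω, hω, h'⟩ := hA.exists_mem_of_ae (P := fun ω => ∀ c ∈ s.range, s ω ≠ c) (by
    have := (Finset.eventually_all s.range).2 fun c _ => h c
    filter_upwards [this] with ω h1 h2 c hc
    exact h1 c hc h2)
  exact h' _ (s.mem_range_self ω) rfl

/-- Almost every point of the atom sees the same constants along the approximating simple functions,
hence the same limit. -/
theorem IsAtom.ae_const {A : Set Ω} (hA : IsAtom μ A) {g : Ω → X}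
    (hg : AEFinStronglyMeasurable g μ) : ∃ c, ∀ᵐ ω ∂μ, ω ∈ A → g ω = c := by
  obtain ⟨k, ⟨s, -, hlim⟩, hgk⟩ := hg
  choose c hc using fun n => hA.ae_const_simpleFunc (s n)
  have hall : ∀ᵐ ω ∂μ, ω ∈ A → ∀ n, s n ω = c n := by
    filter_upwards [ae_all_iff.2 hc] with ω h1 h2 n
    exact h1 n h2
  obtain ⟨ω₀, -, h0⟩ := hA.exists_mem_of_ae hall
  refine ⟨k ω₀, ?_⟩
  filter_upwards [hall, hgk] with ω h1 h2 h3
  rw [h2]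
  refine tendsto_nhds_unique (hlim ω) ?_
  simp only [h1 h3, ← h0]
  exact hlim ω₀

/-- The essential value on an atom. -/
noncomputable def atomVal {A : Set Ω} (hA : IsAtom μ A) (f : Linf 𝕜 X μ) : X :=
  (hA.ae_const f.2).choose

theorem atomVal_spec {A : Set Ω} (hA : IsAtom μ A) (f : Linf 𝕜 X μ) :
    ∀ᵐ ω ∂μ, ω ∈ A → (f : Lp X ∞ μ) ω = atomVal hA f :=
  (hA.ae_const f.2).choose_spec

theorem atomVal_eq {A : Set Ω} (hA : IsAtom μ A) (f : Linf 𝕜 X μ) {c : X}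
    (h : ∀ᵐ ω ∂μ, ω ∈ A → (f : Lp X ∞ μ) ω = c) : atomVal hA f = c := by
  obtain ⟨ω, -, h1, h2⟩ := hA.exists_mem_of_ae (P := fun ω =>
    (f : Lp X ∞ μ) ω = atomVal hA f ∧ (f : Lp X ∞ μ) ω = c) (by
      filter_upwards [atomVal_spec hA f, h] with ω h1 h2 h3
      exact ⟨h1 h3, h2 h3⟩)
  exact h1.symm.trans h2

theorem norm_atomVal_le {A : Set Ω} (hA : IsAtom μ A) (f : Linf 𝕜 X μ) :
    ‖atomVal hA f‖ ≤ ‖f‖ := by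
  obtain ⟨ω, -, h1, h2⟩ := hA.exists_mem_of_ae (P := fun ω =>
    (f : Lp X ∞ μ) ω = atomVal hA f ∧ ‖(f : Lp X ∞ μ) ω‖ ≤ ‖f‖) (by
      filter_upwards [atomVal_spec hA f, Linf.ae_norm_le f] with ω h1 h2 h3
      exact ⟨h1 h3, h2⟩)
  rwa [← h1]

variable {J : Type*} [Fintype J] {A : J → Set Ω}

/-- Distinct atoms may overlap in a null set, where the defining sum has several terms. -/
theorem ae_stepFun (hd : Pairwise fun i j => AEDisjoint μ (A i) (A j)) (v : J → X) :
    ∀ᵐ ω ∂μ, ∀ j, ω ∈ A j → stepFun A v ω = v j := by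
  have h : ∀ᵐ ω ∂μ, ∀ i j, i ≠ j → ω ∉ A i ∩ A j := by
    refine ae_all_iff.2 fun i => ae_all_iff.2 fun j => ?_
    by_cases hij : i = j
    · exact Eventually.of_forall fun _ h => absurd hij h
    · exact (measure_eq_zero_iff_ae_notMem.1 (hd hij)).mono fun _ h _ => h
  filter_upwards [h] with ω h1 j hj
  rw [stepFun, Finset.sum_eq_single j, Set.indicator_of_mem hj]
  · exact fun i _ hij => Set.indicator_of_notMem (fun hi => h1 i j hij ⟨hi, hj⟩) _
  · exact fun h => absurd (Finset.mem_univ j) h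

theorem aefsm_stepFun (hA : ∀ j, IsAtom μ (A j)) (v : J → X) :
    AEFinStronglyMeasurable (stepFun A v) μ := by
  refine FinStronglyMeasurable.aefinStronglyMeasurable
    (finStronglyMeasurable_iff_stronglyMeasurable_and_exists_set_sigmaFinite.2
      ⟨?_, ⋃ j, A j, MeasurableSet.iUnion fun j => (hA j).1, fun ω hω => stepFun_of_notMem v hω,
        ?_⟩)
  · exact Finset.stronglyMeasurable_fun_sum _ fun j _ =>
      stronglyMeasurable_const.indicator (hA j).1
  · have : IsFiniteMeasure (μ.restrict (⋃ j, A j)) := ⟨by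
      rw [Measure.restrict_apply_univ]
      exact (measure_iUnion_fintype_le μ A).trans_lt
        (ENNReal.sum_lt_top.2 fun j _ => (hA j).2.2.1)⟩
    infer_instance

theorem norm_stepFun_le (hd : Pairwise fun i j => AEDisjoint μ (A i) (A j)) (v : J → X) :
    ∀ᵐ ω ∂μ, ‖stepFun A v ω‖ ≤ ‖v‖ := by
  filter_upwards [ae_stepFun hd v] with ω h1
  by_cases h : ω ∈ ⋃ j, A j
  · obtain ⟨j, hj⟩ := Set.mem_iUnion.1 h
    rw [h1 j hj]
    exact norm_le_pi_norm v j
  · rw [stepFun_of_notMem v h, norm_zero]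
    exact norm_nonneg v

/-- The element of `L_∞(μ, X)` with the value `v j` on the atom `A j`. -/
noncomputable def stepLinf (𝕜 : Type*) [RCLike 𝕜] [NormedSpace 𝕜 X] (hA : ∀ j, IsAtom μ (A j))
    (hd : Pairwise fun i j => AEDisjoint μ (A i) (A j)) (v : J → X) : Linf 𝕜 X μ :=
  toLinf 𝕜 (stepFun A v) (aefsm_stepFun hA v) ⟨_, norm_stepFun_le hd v⟩

theorem coe_stepLinf (hA : ∀ j, IsAtom μ (A j))
    (hd : Pairwise fun i j => AEDisjoint μ (A i) (A j)) (v : J → X) :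
    ∀ᵐ ω ∂μ, (stepLinf 𝕜 hA hd v : Lp X ∞ μ) ω = stepFun A v ω :=
  coe_toLinf _ _ _

/-- The values on finitely many atoms. -/
noncomputable def atomProj (𝕜 X : Type*) [RCLike 𝕜] [NormedAddCommGroup X] [NormedSpace 𝕜 X]
    (hA : ∀ j, IsAtom μ (A j)) : Linf 𝕜 X μ →L[𝕜] (J → X) :=
  LinearMap.mkContinuous
    { toFun := fun f j => atomVal (hA j) f
      map_add' := fun f g => funext fun j => atomVal_eq (hA j) _ (by
        filter_upwards [Linf.coe_add f g, atomVal_spec (hA j) f, atomVal_spec (hA j) g]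
          with ω h1 h2 h3 h4
        rw [h1, h2 h4, h3 h4]
        rfl)
      map_smul' := fun c f => funext fun j => atomVal_eq (hA j) _ (by
        filter_upwards [Linf.coe_smul c f, atomVal_spec (hA j) f] with ω h1 h2 h4
        rw [h1, h2 h4]
        rfl) } 1
    (fun f => by
      rw [one_mul]
      exact (pi_norm_le_iff_of_nonneg (norm_nonneg f)).2 fun j => norm_atomVal_le (hA j) f)

theorem atomProj_apply (hA : ∀ j, IsAtom μ (A j)) (f : Linf 𝕜 X μ) (j : J) :
    atomProj 𝕜 X hA f j = atomVal (hA j) f := rfl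

/-- `stepLinf` as a continuous linear map. -/
noncomputable def stepIncl (𝕜 X : Type*) [RCLike 𝕜] [NormedAddCommGroup X] [NormedSpace 𝕜 X]
    (hA : ∀ j, IsAtom μ (A j)) (hd : Pairwise fun i j => AEDisjoint μ (A i) (A j)) :
    (J → X) →L[𝕜] Linf 𝕜 X μ :=
  LinearMap.mkContinuous
    { toFun := stepLinf 𝕜 hA hd
      map_add' := fun v w => Linf.ext_ae (by
        filter_upwards [coe_stepLinf (𝕜 := 𝕜) hA hd (v + w), coe_stepLinf (𝕜 := 𝕜) hA hd v,
          coe_stepLinf (𝕜 := 𝕜) hA hd w,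
          Linf.coe_add (stepLinf 𝕜 hA hd v) (stepLinf 𝕜 hA hd w)] with ω h1 h2 h3 h4
        rw [h1, h4, h2, h3]
        simp only [stepFun, ← Finset.sum_add_distrib]
        refine Finset.sum_congr rfl fun j _ => ?_
        by_cases h : ω ∈ A j <;> simp [h])
      map_smul' := fun c v => Linf.ext_ae (by
        filter_upwards [coe_stepLinf (𝕜 := 𝕜) hA hd (c • v), coe_stepLinf (𝕜 := 𝕜) hA hd v,
          Linf.coe_smul c (stepLinf 𝕜 hA hd v)] with ω h1 h2 h3
        rw [h1, RingHom.id_apply, h3, h2]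
        simp only [stepFun, Finset.smul_sum]
        refine Finset.sum_congr rfl fun j _ => ?_
        by_cases h : ω ∈ A j <;> simp [h]) } 1
    (fun v => by
      rw [one_mul, LinearMap.coe_mk, AddHom.coe_mk, Linf.norm_le_iff _ (norm_nonneg v)]
      filter_upwards [coe_stepLinf (𝕜 := 𝕜) hA hd v, norm_stepFun_le hd v] with ω h1 h2
      rwa [h1])

theorem coe_stepIncl (hA : ∀ j, IsAtom μ (A j))
    (hd : Pairwise fun i j => AEDisjoint μ (A i) (A j)) (v : J → X) :
    ∀ᵐ ω ∂μ, (stepIncl 𝕜 X hA hd v : Lp X ∞ μ) ω = stepFun A v ω :=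
  coe_stepLinf hA hd v

theorem atomProj_stepIncl (hA : ∀ j, IsAtom μ (A j))
    (hd : Pairwise fun i j => AEDisjoint μ (A i) (A j)) (v : J → X) :
    atomProj 𝕜 X hA (stepIncl 𝕜 X hA hd v) = v := by
  ext j
  rw [atomProj_apply]
  refine atomVal_eq (hA j) _ ?_
  filter_upwards [coe_stepIncl (𝕜 := 𝕜) hA hd v, ae_stepFun hd v] with ω h1 h2 h3
  exact h1.trans (h2 j h3)

theorem coe_sub_stepIncl (hA : ∀ j, IsAtom μ (A j))
    (hd : Pairwise fun i j => AEDisjoint μ (A i) (A j)) (f : Linf 𝕜 X μ) : ∀ᵐ ω ∂μ,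
    (ω ∈ ⋃ j, A j → ((f - stepIncl 𝕜 X hA hd (atomProj 𝕜 X hA f) : Linf 𝕜 X μ) :
      Lp X ∞ μ) ω = 0) ∧
    (ω ∉ ⋃ j, A j → ((f - stepIncl 𝕜 X hA hd (atomProj 𝕜 X hA f) : Linf 𝕜 X μ) :
      Lp X ∞ μ) ω = (f : Lp X ∞ μ) ω) := by
  have hval : ∀ᵐ ω ∂μ, ∀ j, ω ∈ A j → (f : Lp X ∞ μ) ω = atomProj 𝕜 X hA f j :=
    ae_all_iff.2 fun j => atomVal_spec (hA j) f
  generalize atomProj 𝕜 X hA f = v at hval ⊢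
  filter_upwards [hval, coe_stepIncl (𝕜 := 𝕜) hA hd v, Linf.coe_sub f (stepIncl 𝕜 X hA hd v),
    ae_stepFun hd v] with ω h1 h2 h3 h5
  rw [h3, h2]
  refine ⟨fun h => ?_, fun h => ?_⟩
  · obtain ⟨j, hj⟩ := Set.mem_iUnion.1 h
    rw [h1 j hj, h5 j hj, sub_self]
  · rw [stepFun_of_notMem v h, sub_zero]

theorem norm_eq_max_atomProj (hA : ∀ j, IsAtom μ (A j))
    (hd : Pairwise fun i j => AEDisjoint μ (A i) (A j)) (f : Linf 𝕜 X μ) :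
    ‖f‖ = max ‖atomProj 𝕜 X hA f‖ ‖f - stepIncl 𝕜 X hA hd (atomProj 𝕜 X hA f)‖ := by
  have hval : ∀ᵐ ω ∂μ, ∀ j, ω ∈ A j → (f : Lp X ∞ μ) ω = atomProj 𝕜 X hA f j :=
    ae_all_iff.2 fun j => atomVal_spec (hA j) f
  have hle : ‖atomProj 𝕜 X hA f‖ ≤ ‖f‖ :=
    (pi_norm_le_iff_of_nonneg (norm_nonneg f)).2 fun j => norm_atomVal_le (hA j) f
  have hsub := coe_sub_stepIncl hA hd f
  generalize atomProj 𝕜 X hA f = v at hval hle hsub ⊢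
  generalize f - stepIncl 𝕜 X hA hd v = g at hsub ⊢
  apply le_antisymm
  · rw [Linf.norm_le_iff _ (by positivity)]
    filter_upwards [hval, hsub, Linf.ae_norm_le g] with ω h1 h2 h4
    by_cases h : ω ∈ ⋃ j, A j
    · obtain ⟨j, hj⟩ := Set.mem_iUnion.1 h
      rw [h1 j hj]
      exact le_max_of_le_left (norm_le_pi_norm v j)
    · rw [h2.2 h] at h4
      exact le_max_of_le_right h4
  · refine max_le hle ?_
    rw [Linf.norm_le_iff _ (norm_nonneg f)]
    filter_upwards [hsub, Linf.ae_norm_le f] with ω h1 h4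
    by_cases h : ω ∈ ⋃ j, A j
    · rw [h1.1 h, norm_zero]
      exact norm_nonneg f
    · rwa [h1.2 h]

/-- The values on finitely many atoms, as an `ℓ_∞`-summand of `L_∞(μ, X)`. -/
noncomputable def atomSummand (𝕜 X : Type*) [RCLike 𝕜] [NormedAddCommGroup X] [NormedSpace 𝕜 X]
    (hA : ∀ j, IsAtom μ (A j)) (hd : Pairwise fun i j => AEDisjoint μ (A i) (A j)) :
    MSummand 𝕜 (Linf 𝕜 X μ) (J → X) where
  proj := atomProj 𝕜 X hA
  incl := stepIncl 𝕜 X hA hd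
  proj_incl := atomProj_stepIncl hA hd
  norm_eq := norm_eq_max_atomProj hA hd

variable (hA : ∀ j, IsAtom μ (A j)) (hd : Pairwise fun i j => AEDisjoint μ (A i) (A j))

theorem incl_proj_of_ae (f : Linf 𝕜 X μ)
    (h : ∀ᵐ ω ∂μ, ω ∉ ⋃ j, A j → (f : Lp X ∞ μ) ω = 0) :
    (atomSummand 𝕜 X hA hd).incl ((atomSummand 𝕜 X hA hd).proj f) = f := by
  refine (sub_eq_zero.1 (Linf.ext_ae ?_)).symm
  filter_upwards [coe_sub_stepIncl hA hd f, h, Linf.coe_zero (𝕜 := 𝕜) (X := X) (μ := μ)]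
    with ω h1 h2 h3
  rw [h3]
  by_cases h4 : ω ∈ ⋃ j, A j
  · exact h1.1 h4
  · exact (h1.2 h4).trans (h2 h4)

theorem atomVal_restr {A B : Set Ω} (hA : IsAtom μ A) (hAB : A ⊆ B)
    (f : Linf 𝕜 X μ) : atomVal (hA.restrict hAB) (restr f B) = atomVal hA f := by
  refine atomVal_eq _ _ ?_
  filter_upwards [coe_restr f B, ae_restrict_of_ae (atomVal_spec hA f)] with ω h1 h2 h3
  rw [h1, h2 h3]

theorem ae_restrict_atomVal {A B : Set Ω} (hA : IsAtom μ A) (hAB : A ⊆ B)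
    (g : Linf 𝕜 X (μ.restrict B)) :
    ∀ᵐ ω ∂μ.restrict A, (g : Lp X ∞ (μ.restrict B)) ω = atomVal (hA.restrict hAB) g := by
  have h := atomVal_spec (hA.restrict hAB) g
  rw [← ae_restrict_iff' hA.1, Measure.restrict_restrict hA.1, Set.inter_eq_left.2 hAB] at h
  exact h

/-- `L_∞` of a finite union of atoms is a finite `ℓ_∞`-power of `X`. -/
noncomputable def unionEquiv (𝕜 X : Type*) [RCLike 𝕜] [NormedAddCommGroup X] [NormedSpace 𝕜 X]
    (hA : ∀ j, IsAtom μ (A j)) (hd : Pairwise fun i j => AEDisjoint μ (A i) (A j)) :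
    Linf 𝕜 X (μ.restrict (⋃ j, A j)) ≃ₗᵢ[𝕜] (J → X) :=
  (atomSummand 𝕜 X (μ := μ.restrict (⋃ j, A j))
    (fun j => (hA j).restrict (Set.subset_iUnion A j))
    (fun _ _ hij => Measure.restrict_le_self.absolutelyContinuous (hd hij))).toEquiv
    fun f => incl_proj_of_ae _ _ f (by
      filter_upwards [ae_restrict_mem (MeasurableSet.iUnion fun j => (hA j).1)] with ω h1 h2
      exact absurd h1 h2)

/-- `L_∞` of an atom is `X`. -/
noncomputable def atomEquiv (𝕜 X : Type*) [RCLike 𝕜] [NormedAddCommGroup X] [NormedSpace 𝕜 X]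
    {A : Set Ω} (hA : IsAtom μ A) : Linf 𝕜 X (μ.restrict A) ≃ₗᵢ[𝕜] X :=
  ((atomSummand 𝕜 X (J := Unit) (A := fun _ => A) (fun _ => hA.restrict subset_rfl)
    (fun _ _ h => absurd rfl h)).toEquiv fun f => incl_proj_of_ae _ _ f (by
      filter_upwards [ae_restrict_mem hA.1] with ω h1 h2
      exact absurd (Set.mem_iUnion.2 ⟨(), h1⟩) h2)).trans
  ((MSummand.coord 𝕜 X ()).toEquiv fun v => by
    ext j
    simp [MSummand.coord])

/-- Outside finitely many atoms, a function which is not almost normed by an atomless set or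
infinitely many atoms is bounded away from its norm. -/
theorem exists_bound_off_norming_atoms {I : Type*} {A : I → Set Ω} (hA : IsAtomEnumeration μ A)
    {f : Linf 𝕜 X μ} (hf : ‖f‖ = 1) (h1 : ¬ HasAtomlessNormingSet f)
    (h2 : ¬ HasInfinitelyManyAlmostNormingAtoms A f) :
    {i | ‖restr f (A i)‖ = 1}.Finite ∧ ∃ r : ℝ, 0 ≤ r ∧ r < 1 ∧
      ∀ᵐ ω ∂μ, (∀ i, ‖restr f (A i)‖ = 1 → ω ∉ A i) → ‖(f : Lp X ∞ μ) ω‖ ≤ r := by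
  simp only [HasInfinitelyManyAlmostNormingAtoms, not_forall, Set.not_infinite] at h2
  obtain ⟨ε, hε, hfin⟩ := h2
  have hle : ∀ i, ‖restr f (A i)‖ ≤ 1 := fun i => hf ▸ norm_restr_le f (hA.1 i).1
  set s := max 0 (1 - ε / 2) with hs
  have hs1 : s < 1 := max_lt one_pos (by linarith)
  set F := {i | 1 - ε / 2 < ‖restr f (A i)‖} with hF
  refine ⟨hfin.subset fun i hi => ?_, ?_⟩
  · simp only [Set.mem_ofPred_eq] at hi
    simp only [hF, Set.mem_ofPred_eq, hi]
    linarith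
  obtain ⟨G, hG, hGf⟩ := exists_measurableSet_lt_norm f s
  have hU : MeasurableSet (⋃ i ∈ F, A i) := hfin.measurableSet_biUnion fun i _ => (hA.1 i).1
  -- On an atom inside `G` the norm of `f` exceeds `s ≥ 1 - ε / 2`, so that atom is one of those in
  -- `F` and has been removed.
  have hGa : IsAtomless μ (G \ ⋃ i ∈ F, A i) := by
    intro B hB hBa
    obtain ⟨i, hi⟩ := hA.2.2 B hBa
    have hlt : s < ‖restr f (A i)‖ := by
      refine lt_norm_restr f (hA.1 i).1 (hA.1 i).2.1 ?_
      filter_upwards [hi.mem_iff, hGf] with ω h3 h4 h5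
      exact h4.1 (hB (h3.2 h5)).1
    have hiF : i ∈ F := lt_of_le_of_lt (le_max_right _ _) hlt
    obtain ⟨ω, hω, h3⟩ := hBa.exists_mem_of_ae (P := fun ω => ω ∈ A i)
      (hi.mem_iff.mono fun ω h => h.1)
    exact (hB hω).2 (Set.mem_biUnion hiF h3)
  have hlt : ‖restr f (G \ ⋃ i ∈ F, A i)‖ < 1 := by
    refine lt_of_le_of_ne (hf ▸ norm_restr_le f (hG.diff hU)) fun h => h1 ?_
    refine ⟨_, hG.diff hU, ?_, hGa, h⟩
    filter_upwards [hGf] with ω h3 h4 h5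
    have := h3.1 h4.1
    rw [h5, norm_zero] at this
    exact (le_max_left _ _).not_gt this
  obtain ⟨t, ht1, ht⟩ : ∃ t : ℝ, t < 1 ∧ ∀ i ∈ F, ‖restr f (A i)‖ ≠ 1 → ‖restr f (A i)‖ ≤ t := by
    have hfin' : (F ∩ {i | ‖restr f (A i)‖ ≠ 1}).Finite := hfin.inter_of_left _
    rcases (F ∩ {i | ‖restr f (A i)‖ ≠ 1}).eq_empty_or_nonempty with he | hne
    · refine ⟨0, one_pos, fun i hi hi1 => ?_⟩
      have : i ∈ F ∩ {i | ‖restr f (A i)‖ ≠ 1} := ⟨hi, hi1⟩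
      rw [he] at this
      exact this.elim
    · obtain ⟨i, hi, hmax⟩ := Set.exists_max_image _ (fun i => ‖restr f (A i)‖) hfin' hne
      exact ⟨_, lt_of_le_of_ne (hle i) hi.2, fun k hk hk1 => hmax k ⟨hk, hk1⟩⟩
  -- The three bounds are for the points outside `G`, for `G` without the atoms in `F`, and for the
  -- atoms in `F` that do not norm `f`.
  refine ⟨max s (max ‖restr f (G \ ⋃ i ∈ F, A i)‖ t), le_max_of_le_left (le_max_left _ _),
    max_lt hs1 (max_lt hlt ht1), ?_⟩
  have hF' : ∀ᵐ ω ∂μ, ∀ i ∈ F, ω ∈ A i → ‖(f : Lp X ∞ μ) ω‖ ≤ ‖restr f (A i)‖ :=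
    (ae_ball_iff hfin.countable).2 fun i _ =>
      (norm_restr_le_iff f (hA.1 i).1 (norm_nonneg _)).1 le_rfl
  filter_upwards [hGf, hF', (norm_restr_le_iff f (hG.diff hU) (norm_nonneg _)).1 le_rfl]
    with ω h3 h4 h5 h6
  by_cases hωF : ω ∈ ⋃ i ∈ F, A i
  · obtain ⟨i, hi, hωi⟩ := Set.mem_iUnion₂.1 hωF
    exact (h4 i hi hωi).trans ((ht i hi fun h => h6 i h hωi).trans
      (le_max_of_le_right (le_max_right _ _)))
  · by_cases hωG : ω ∈ G
    · exact (h5 ⟨hωG, hωF⟩).trans (le_max_of_le_right (le_max_left _ _))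
    · exact le_max_of_le_left (not_lt.1 fun h => hωG (h3.2 h))

/-- The complement of the atoms provides a nonzero element of the complementary summand. -/
theorem exists_ne_zero_proj_eq_zero (hA : ∀ j, IsAtom μ (A j))
    (hd : Pairwise fun i j => AEDisjoint μ (A i) (A j)) (h : HasFinitePart μ (⋃ j, A j)ᶜ) {x₀ : X}
    (hx₀ : x₀ ≠ 0) : ∃ w : Linf 𝕜 X μ, w ≠ 0 ∧ (atomSummand 𝕜 X hA hd).proj w = 0 := by
  obtain ⟨T, hT, hTs, hT0, hTfin⟩ := h
  have hm : AEFinStronglyMeasurable (T.indicator fun _ => x₀) μ := by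
    refine FinStronglyMeasurable.aefinStronglyMeasurable
      (finStronglyMeasurable_iff_stronglyMeasurable_and_exists_set_sigmaFinite.2
        ⟨stronglyMeasurable_const.indicator hT, T, hT,
          fun ω hω => Set.indicator_of_notMem hω _, ?_⟩)
    have : IsFiniteMeasure (μ.restrict T) := ⟨by rwa [Measure.restrict_apply_univ]⟩
    infer_instance
  have hb : ∃ C : ℝ, ∀ᵐ ω ∂μ, ‖T.indicator (fun _ => x₀) ω‖ ≤ C :=
    ⟨‖x₀‖, Eventually.of_forall fun ω => norm_indicator_le_norm_self _ _⟩
  refine ⟨toLinf 𝕜 _ hm hb, fun h0 => ?_, funext fun j => atomVal_eq (hA j) _ ?_⟩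
  · refine hT0.ne' (measure_eq_zero_iff_ae_notMem.2 ?_)
    have h1 := coe_toLinf (𝕜 := 𝕜) _ hm hb
    rw [h0] at h1
    filter_upwards [h1, Linf.coe_zero (𝕜 := 𝕜) (X := X) (μ := μ)] with ω h1 h2 h3
    rw [h2, Set.indicator_of_mem h3] at h1
    exact hx₀ h1.symm
  · filter_upwards [coe_toLinf (𝕜 := 𝕜) _ hm hb] with ω h1 h2
    rw [h1, Set.indicator_of_notMem fun h => hTs h (Set.mem_iUnion.2 ⟨j, h2⟩)]
    rfl

end Atoms

end Diametral

/-! ### Assembly of the theorem -/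

theorem mainTheorem9
    {𝕜 : Type*} [RCLike 𝕜]
    {X : Type*} [NormedAddCommGroup X] [NormedSpace 𝕜 X] [CompleteSpace X]
    {Ω : Type*} [MeasurableSpace Ω] (μ : Measure Ω)
    {I : Type*} (A : I → Set Ω) (hA : Diametral.IsAtomEnumeration μ A)
    (A₀ : Set Ω) (hA₀ : Diametral.IsAtom μ A₀) (hA₀c : 0 < μ A₀ᶜ)
    (f : Diametral.Linf 𝕜 X μ) (hf : ‖f‖ = 1) :
    (Diametral.HasAtomlessNormingSet f → Diametral.IsCcsDaugavet 𝕜 f) ∧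
    (Diametral.HasInfinitelyManyAlmostNormingAtoms A f → Diametral.IsDaugavet 𝕜 f) ∧
    (¬ Diametral.HasAtomlessNormingSet f →
      ¬ Diametral.HasInfinitelyManyAlmostNormingAtoms A f →
      ∃ (J : Finset I) (B : Set Ω),
        (∀ i, i ∈ J ↔ ‖Diametral.restr f (A i)‖ = 1) ∧ J.Nonempty ∧ B = (⋃ j ∈ J, A j) ∧
        -- the identifications of the restricted spaces with the `ℓ_∞`-sum of copies of `X`
        -- indexed by `J`, and with `X`
        (∃ Φ : Diametral.Linf 𝕜 X (μ.restrict B) ≃ₗᵢ[𝕜] (J → X),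
          ∀ (g : Diametral.Linf 𝕜 X (μ.restrict B)) (j : J),
            ∀ᵐ ω ∂μ.restrict (A j), (g : Lp X ∞ (μ.restrict B)) ω = Φ g j) ∧
        (∀ j ∈ J, ∃ Φ : Diametral.Linf 𝕜 X (μ.restrict (A j)) ≃ₗᵢ[𝕜] X,
          ∀ g : Diametral.Linf 𝕜 X (μ.restrict (A j)),
            ∀ᵐ ω ∂μ.restrict (A j), (g : Lp X ∞ (μ.restrict (A j))) ω = Φ g) ∧
        ((Diametral.IsSuperDaugavet 𝕜 f ↔ Diametral.IsSuperDaugavet 𝕜 (Diametral.restr f B)) ∧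
          (Diametral.IsSuperDelta 𝕜 f ↔ Diametral.IsSuperDelta 𝕜 (Diametral.restr f B)) ∧
          (Diametral.IsCcsDaugavet 𝕜 f ↔ Diametral.IsCcsDaugavet 𝕜 (Diametral.restr f B))) ∧
        (Diametral.IsDaugavet 𝕜 f ↔
          ∃ j ∈ J, Diametral.IsDaugavet 𝕜 (Diametral.restr f (A j))) ∧
        (Diametral.IsCcsDelta 𝕜 f → Diametral.IsCcsDelta 𝕜 (Diametral.restr f B)) ∧
        (Diametral.IsDelta 𝕜 f ↔
          ((∃ j ∈ J, Diametral.IsDelta 𝕜 (Diametral.restr f (A j))) ∨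
            (2 ≤ J.card ∧
              ∀ p : I → ℝ, (∀ j ∈ J, 1 < p j) → ∑ j ∈ J, 1 / p j = 1 →
                ∃ j ∈ J, Diametral.IsDeltaP 𝕜 (p j) (Diametral.restr f (A j))))) ∧
        -- the scalar field is complex exactly when its imaginary unit is nonzero
        ((Diametral.HasFinitePart μ Bᶜ ∨ (RCLike.I : 𝕜) ≠ 0) →
          (Diametral.IsNabla 𝕜 f ↔ Diametral.IsDaugavet 𝕜 f)) ∧
        (¬ Diametral.HasFinitePart μ Bᶜ →
          (Diametral.IsNabla 𝕜 f ↔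
            ((∀ j ∈ J, Diametral.IsNabla 𝕜 (Diametral.restr f (A j))) ∨
              ∃ j ∈ J, Diametral.IsDaugavet 𝕜 (Diametral.restr f (A j)))) ∧
          ((∃ j ∈ J, Diametral.IsDaugavet 𝕜 (Diametral.restr f (A j))) →
            Diametral.IsDaugavet 𝕜 f))) := by
  refine ⟨Diametral.isCcsDaugavet_of_hasAtomlessNormingSet hf,
    fun h => (Diametral.isCcsDaugavet_of_infinite_atoms hA hf h).isDaugavet, fun h1 h2 => ?_⟩
  obtain ⟨hJfin, r, hr0, hr1, hr⟩ 
    := Diametral.exists_bound_off_norming_atoms hA hf h1 h2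
  have hmemJ : ∀ i, i ∈ hJfin.toFinset ↔ ‖Diametral.restr f (A i)‖ = 1 := fun i => by simp
  generalize hJfin.toFinset = J at hmemJ
  -- Without norming atoms the bound `r < 1` would hold almost everywhere.
  have hJn : J.Nonempty := by
    by_contra hne
    rw [Finset.not_nonempty_iff_eq_empty] at hne
    have : ‖f‖ ≤ r := (Diametral.Linf.norm_le_iff f hr0).2 (hr.mono fun ω h => h fun i hi => by
      have := (hmemJ i).2 hi
      simp [hne] at this)
    linarith
  have hJne : Nonempty J := hJn.to_subtype
  have hAJ : ∀ j : J, Diametral.IsAtom μ (A j) := fun j => hA.1 j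
  have hd : Pairwise fun i j : J => AEDisjoint μ (A i) (A j) := fun i j hij =>
    hA.aedisjoint fun h => hij (Subtype.ext h)
  have hBeq : (⋃ j ∈ J, A j) = ⋃ j : J, A j := Set.biUnion_eq_iUnion _ _
  set M := Diametral.atomSummand 𝕜 X hAJ hd with hM
  have hBproj : Diametral.unionEquiv 𝕜 X hAJ hd (Diametral.restr f (⋃ j : J, A j)) = M.proj f :=
    funext fun j => Diametral.atomVal_restr (hAJ j) (Set.subset_iUnion (fun j : J => A j) j) f
  have hAproj : ∀ j : J, Diametral.atomEquiv 𝕜 X (hAJ j) (Diametral.restr f (A j)) = M.proj f j :=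
    fun j => Diametral.atomVal_restr (hAJ j) subset_rfl f
  have hcompl : ‖f - M.incl (M.proj f)‖ < 1 := by
    refine lt_of_le_of_lt ((Diametral.Linf.norm_le_iff _ hr0).2 ?_) hr1
    filter_upwards [Diametral.coe_sub_stepIncl hAJ hd f, hr] with ω h3 h4
    by_cases h : ω ∈ ⋃ j : J, A j
    · rw [hM]
      refine (congrArg norm (h3.1 h)).trans_le ?_
      rwa [norm_zero]
    · refine (congrArg norm (h3.2 h)).trans_le (h4 fun i hi hω => h ?_)
      exact Set.mem_iUnion.2 ⟨⟨i, (hmemJ i).2 hi⟩, hω⟩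
  have hv : ∀ j, ‖M.proj f j‖ = 1 := fun j => by
    rw [← hAproj, LinearIsometryEquiv.norm_map]
    exact (hmemJ j).1 j.2
  have hex : ∀ P : I → Prop, (∃ j : J, P j) ↔ ∃ j ∈ J, P j := fun P => by simp
  have hDaug : Diametral.IsDaugavet 𝕜 f ↔
      ∃ j ∈ J, Diametral.IsDaugavet 𝕜 (Diametral.restr f (A j)) := by
    rw [M.isDaugavet_iff_proj hf hcompl, Diametral.isDaugavet_pi_iff hv]
    refine (exists_congr fun j => ?_).trans (hex _)
    rw [← hAproj, Diametral.isDaugavet_map_iff]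
  refine ⟨J, _, hmemJ, hJn, rfl, ?_⟩
  rw [hBeq]
  refine ⟨⟨Diametral.unionEquiv 𝕜 X hAJ hd, fun g j => Diametral.ae_restrict_atomVal (hAJ j)
      (Set.subset_iUnion (fun j : J => A j) j) g⟩,
    fun j hj => ⟨Diametral.atomEquiv 𝕜 X (hA.1 j), fun g =>
      Diametral.ae_restrict_atomVal (hA.1 j) subset_rfl g⟩, ⟨?_, ?_, ?_⟩, hDaug, ?_, ?_, ?_, ?_⟩
  · rw [M.isSuperDaugavet_iff_proj hf hcompl, ← hBproj, Diametral.isSuperDaugavet_map_iff]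
  · rw [M.isSuperDelta_iff_proj hf hcompl, ← hBproj, Diametral.isSuperDelta_map_iff]
  · rw [M.isCcsDaugavet_iff_proj hf hcompl, ← hBproj, Diametral.isCcsDaugavet_map_iff]
  · intro h
    have := Diametral.MSummand.isCcsDelta_proj hcompl h
    rwa [← hBproj, Diametral.isCcsDelta_map_iff] at this
  · rw [M.isDelta_iff_proj hf hcompl, Diametral.isDelta_pi_iff hv, Fintype.card_coe]
    refine or_congr ?_ (and_congr_right fun _ => ⟨fun h p hp hp1 => ?_, fun h p hp hp1 => ?_⟩)
    · refine (exists_congr fun j => ?_).trans (hex _)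
      rw [← hAproj, Diametral.isDelta_map_iff]
    · obtain ⟨j, hj⟩ := h (fun j => p j) (fun j => hp j j.2)
        ((Finset.sum_coe_sort J fun i => 1 / p i).trans hp1)
      rw [← hAproj, Diametral.isDeltaP_map_iff _ (one_pos.trans (hp j j.2))] at hj
      exact ⟨j, j.2, hj⟩
    · classical
      -- Exponents on `J` are extended to `I` by the irrelevant value 0.
      obtain ⟨q, hq⟩ : ∃ q : I → ℝ, ∀ j : J, q j = p j :=
        ⟨fun i => if h : i ∈ J then p ⟨i, h⟩ else 0, fun j => by simp⟩
      obtain ⟨j, hj, h'⟩ := h q (fun j hj => hq ⟨j, hj⟩ ▸ hp ⟨j, hj⟩) (by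
        rw [← Finset.sum_coe_sort J fun i => 1 / q i]
        simpa only [hq] using hp1)
      refine ⟨⟨j, hj⟩, ?_⟩
      rw [← hAproj, Diametral.isDeltaP_map_iff _ (one_pos.trans (hp _)), ← hq]
      exact h'
  · refine fun h => ⟨fun hn => ?_, fun h => h.isNabla⟩
    rcases h with h | h
    -- The essential value of `f` on a norming atom supplies a nonzero vector of `X`.
    · obtain ⟨w, hw0, hw⟩ := Diametral.exists_ne_zero_proj_eq_zero (𝕜 := 𝕜) hAJ hd h
        (x₀ := M.proj f hJne.some) (norm_pos_iff.1 ((hv _).symm ▸ one_pos))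
      exact Diametral.MSummand.isDaugavet_of_isNabla hcompl hw0 hw hn
    · exact hn.isDaugavet_of_I_ne_zero h
  · refine fun h => ⟨?_, hDaug.2⟩
    have hB : MeasurableSet (⋃ j : J, A j)ᶜ := (MeasurableSet.iUnion fun j => (hAJ j).1).compl
    -- A function not vanishing off the atoms would yield a set of positive finite measure there, so
    -- the summand is the whole space.
    have hinv : ∀ e, M.incl (M.proj e) = e := fun e => Diametral.incl_proj_of_ae hAJ hd e
      (by_contra fun hcon => h (Diametral.exists_finite_part e hB hcon))
    rw [← Diametral.isNabla_map_iff (M.toEquiv hinv), Diametral.MSummand.toEquiv_apply,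
      Diametral.isNabla_pi_iff hv, Subtype.forall']
    refine or_congr (forall_congr' fun j => ?_) ((exists_congr fun j => ?_).trans (hex _))
    · rw [← hAproj, Diametral.isNabla_map_iff]
    · rw [← hAproj, Diametral.isDaugavet_map_iff]
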